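/- Let $c_1,c_2,c_3\in\mathbb R\setminus\{0\}$ and let $\mathcal Y$ be the junction of three half-lines $E_j=(0,\infty)$ at a common vertex $0$, with $L^2(\mathcal Y)=\bigoplus_{j=1}^3L^2(0,\infty)$ (complex valued) and $H^2(\mathcal Y)=\bigoplus_{j=1}^3H^2(0,\infty)$. Let $\mathcal T$ act as $(v_j)_{j=1}^3\mapsto(-c_j^2v_j'')_{j=1}^3$ on $$D(\mathcal T)=\Big\{(v_j)\in H^2(\mathcal Y): c_1v_1'(0+)=c_2v_2'(0+)=c_3v_3'(0+)=0,\ \sum_{j=1}^3c_jv_j(0+)=0\Big\}.$$ For $\lambda\in\mathbb R$ let $\mathcal T_\lambda$ act by the same expression on $$D(\mathcal T_\lambda)=\Big\{(u_j)\in H^2(\mathcal Y): c_1u_1'(0+)=c_2u_2'(0+)=c_3u_3'(0+),\ \sum_{j=1}^3c_ju_j(0+)=\lambda c_1u_1'(0+)\Big\},$$ and let $\mathcal T_\infty$ (the case $\lambda=\infty$: decoupled Neumann conditions) act by the same expression on $D(\mathcal T_\infty)=\{(u_j)\in H^2(\mathcal Y): u_1'(0+)=u_2'(0+)=u_3'(0+)=0\}$.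 Then: 1. $\mathcal T$ is densely defined, closed and symmetric, and its deficiency indices $n_\pm(\mathcal T)=\dim\ker(\mathcal T^*\mp i)$ are both equal to $1$. 2. The self-adjoint extensions of $\mathcal T$ are exactly the operators $\mathcal T_\lambda$ with $\lambda\in\mathbb R\cup\{\infty\}$. 3. For every real $\lambda\neq0$, $\sigma_{\mathrm{ess}}(\mathcal T_\lambda)=[0,\infty)$. 4. For every real $\lambda<0$, $\mathcal T_\lambda$ has precisely one negative eigenvalue, and this eigenvalue is simple. 5. For every real $\lambda>0$, $\mathcal T_\lambda$ has no eigenvalues. -/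

import Mathlib

open MeasureTheory
open scoped ContDiff

noncomputable section

/-! ### Unbounded operators in a complex Hilbert space -/

namespace UnboundedOp

variable {E : Type*} [NormedAddCommGroup E] [InnerProductSpace ℂ E]

/-- `ker (A - z)`: the vectors `u ∈ D(A)` with `A u = z u`, as a subspace of the whole space. -/
def eigenspace (A : E →ₗ.[ℂ] E) (z : ℂ) : Submodule ℂ E :=
  A.graph.comap (LinearMap.id.prod (z • LinearMap.id))

/-- `z` is an eigenvalue of `A`. -/
def IsEigenvalue (A : E →ₗ.[ℂ] E) (z : ℂ) : Prop :=
  eigenspace A z ≠ ⊥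

/-- The resolvent set: `A - z : D(A) → E` is a bijection with a bounded inverse `R`. -/
def resolventSet (A : E →ₗ.[ℂ] E) : Set ℂ :=
  {z | ∃ R : E →L[ℂ] E,
    (∀ f : E, ∃ hf : R f ∈ A.domain, A ⟨R f, hf⟩ - z • R f = f) ∧
    ∀ u : A.domain, R (A u - z • (u : E)) = u}

/-- The spectrum, the complement of the resolvent set. -/
def spectrum (A : E →ₗ.[ℂ] E) : Set ℂ := (resolventSet A)ᶜ

/-- The discrete spectrum: isolated points of the spectrum that are eigenvalues of finite
multiplicity. -/
def discreteSpectrum (A : E →ₗ.[ℂ] E) : Set ℂ :=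
  {z | z ∈ spectrum A ∧ (∃ ε > 0, ∀ w ∈ spectrum A, ‖w - z‖ < ε → w = z) ∧
    IsEigenvalue A z ∧ FiniteDimensional ℂ (eigenspace A z)}

/-- The essential spectrum (of a self-adjoint operator): the spectrum without the discrete
spectrum. -/
def essentialSpectrum (A : E →ₗ.[ℂ] E) : Set ℂ := spectrum A \ discreteSpectrum A

/-- The deficiency index `n₊(A) = dim ker (A* - i)`. -/
def deficiencyPlus [CompleteSpace E] (A : E →ₗ.[ℂ] E) : Cardinal :=
  Module.rank ℂ (eigenspace A.adjoint Complex.I)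

/-- The deficiency index `n₋(A) = dim ker (A* + i)`. -/
def deficiencyMinus [CompleteSpace E] (A : E →ₗ.[ℂ] E) : Cardinal :=
  Module.rank ℂ (eigenspace A.adjoint (-Complex.I))

end UnboundedOp

/-! ### The junction of three half-lines -/

namespace YJunction

/-- `L²(0, ∞)`, complex valued. -/
abbrev L2Half : Type := Lp ℂ 2 (volume.restrict (Set.Ioi (0 : ℝ)))

/-- `L²(𝒴) = L²(0, ∞) ⊕ L²(0, ∞) ⊕ L²(0, ∞)`, with the Hilbert direct sum inner product. -/
abbrev L2Y : Type := PiLp 2 (fun _ : Fin 3 => L2Half)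

/-- `g` is the weak derivative of `f` on `(0, ∞)`. -/
def IsWeakDeriv (f g : L2Half) : Prop :=
  ∀ φ : ℝ → ℝ, ContDiff ℝ ∞ φ → HasCompactSupport φ → tsupport φ ⊆ Set.Ioi 0 →
    ∫ x in Set.Ioi (0 : ℝ), deriv φ x • f x = -∫ x in Set.Ioi (0 : ℝ), φ x • g x

/-- `f(0+) = a`: the function `f` has a representative that is continuous on `[0, ∞)`,
with value `a` at `0`. (Every `f ∈ H¹(0, ∞)` has such a representative.) -/
def HasTrace (f : L2Half) (a : ℂ) : Prop :=
  ∃ g : ℝ → ℂ, ContinuousOn g (Set.Ici 0) ∧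
    f =ᵐ[volume.restrict (Set.Ioi (0 : ℝ))] g ∧ g 0 = a

lemma integrable_smul_test (f : L2Half) {φ : ℝ → ℝ} (hφ : Continuous φ)
    (hc : HasCompactSupport φ) :
    Integrable (fun x => φ x • f x) (volume.restrict (Set.Ioi (0 : ℝ))) := by
  have h1 : MemLp φ 2 (volume.restrict (Set.Ioi (0 : ℝ))) :=
    (hφ.memLp_of_hasCompactSupport hc).restrict _
  exact memLp_one_iff_integrable.1 ((Lp.memLp f).smul h1)

lemma IsWeakDeriv.add {f g f' g' : L2Half} (h : IsWeakDeriv f g) (h' : IsWeakDeriv f' g') :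
    IsWeakDeriv (f + f') (g + g') := by
  intro φ hφ hc hs
  have e1 : ∫ x in Set.Ioi (0 : ℝ), deriv φ x • (f + f' : L2Half) x
      = ∫ x in Set.Ioi (0 : ℝ), (deriv φ x • f x + deriv φ x • f' x) := by
    refine integral_congr_ae ?_
    filter_upwards [Lp.coeFn_add f f'] with x hx
    rw [hx, Pi.add_apply, smul_add]
  have e2 : ∫ x in Set.Ioi (0 : ℝ), φ x • (g + g' : L2Half) x
      = ∫ x in Set.Ioi (0 : ℝ), (φ x • g x + φ x • g' x) := by
    refine integral_congr_ae ?_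
    filter_upwards [Lp.coeFn_add g g'] with x hx
    rw [hx, Pi.add_apply, smul_add]
  have hd : Continuous (deriv φ) := hφ.continuous_deriv (by simp)
  rw [e1, e2, integral_add (integrable_smul_test f hd hc.deriv)
    (integrable_smul_test f' hd hc.deriv), integral_add (integrable_smul_test g hφ.continuous hc)
    (integrable_smul_test g' hφ.continuous hc), h φ hφ hc hs, h' φ hφ hc hs]
  ring

lemma IsWeakDeriv.smul {f g : L2Half} (z : ℂ) (h : IsWeakDeriv f g) :
    IsWeakDeriv (z • f) (z • g) := by
  intro φ hφ hc hs
  have e1 : ∫ x in Set.Ioi (0 : ℝ), deriv φ x • (z • f : L2Half) x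
      = ∫ x in Set.Ioi (0 : ℝ), z • (deriv φ x • f x) := by
    refine integral_congr_ae ?_
    filter_upwards [Lp.coeFn_smul z f] with x hx
    rw [hx, Pi.smul_apply, smul_comm]
  have e2 : ∫ x in Set.Ioi (0 : ℝ), φ x • (z • g : L2Half) x
      = ∫ x in Set.Ioi (0 : ℝ), z • (φ x • g x) := by
    refine integral_congr_ae ?_
    filter_upwards [Lp.coeFn_smul z g] with x hx
    rw [hx, Pi.smul_apply, smul_comm]
  rw [e1, e2, integral_smul, integral_smul, h φ hφ hc hs, smul_neg]

lemma isWeakDeriv_zero : IsWeakDeriv 0 0 := by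
  intro φ hφ hc hs
  have e : ∀ ψ : ℝ → ℝ, ∫ x in Set.Ioi (0 : ℝ), ψ x • (0 : L2Half) x = 0 := by
    intro ψ
    refine integral_eq_zero_of_ae ?_
    filter_upwards [Lp.coeFn_zero ℂ 2 (volume.restrict (Set.Ioi (0 : ℝ)))] with x hx
    rw [hx]
    simp
  rw [e, e, neg_zero]

/-- Weak derivatives are unique. -/
lemma IsWeakDeriv.unique {f g g' : L2Half} (h : IsWeakDeriv f g) (h' : IsWeakDeriv f g') :
    g = g' := by
  have hd : IsWeakDeriv 0 (g - g') := by
    have := h.add (h'.smul (-1))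
    simpa [sub_eq_add_neg] using this
  have hloc : LocallyIntegrableOn (fun x => (g - g' : L2Half) x) (Set.Ioi (0 : ℝ)) volume := by
    rw [locallyIntegrableOn_iff isOpen_Ioi.isLocallyClosed]
    intro K hK hKc
    have h1 : MemLp (fun x => (g - g' : L2Half) x) 2 (volume.restrict K) :=
      (Lp.memLp (g - g')).mono_measure (Measure.restrict_mono hK le_rfl)
    have : IsFiniteMeasure (volume.restrict K) :=
      ⟨by simpa using hKc.measure_lt_top⟩
    exact h1.integrable (by norm_num)
  have hz := isOpen_Ioi.ae_eq_zero_of_integral_contDiff_smul_eq_zero hloc (by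
    intro φ hφ hc hs
    have h1 := hd φ hφ hc hs
    have h0 : ∫ x in Set.Ioi (0 : ℝ), deriv φ x • (0 : L2Half) x = 0 := by
      refine integral_eq_zero_of_ae ?_
      filter_upwards [Lp.coeFn_zero ℂ 2 (volume.restrict (Set.Ioi (0 : ℝ)))] with x hx
      rw [hx]
      simp
    rw [h0, eq_comm, neg_eq_zero, setIntegral_eq_integral_of_forall_compl_eq_zero] at h1
    · exact h1
    · intro x hx
      rw [image_eq_zero_of_notMem_tsupport (fun h => hx (hs h)), zero_smul])
  rw [← sub_eq_zero]
  refine (Lp.eq_zero_iff_ae_eq_zero).2 ?_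
  exact (ae_restrict_iff' measurableSet_Ioi).2 hz

lemma HasTrace.add {f f' : L2Half} {a a' : ℂ} (h : HasTrace f a) (h' : HasTrace f' a') :
    HasTrace (f + f') (a + a') := by
  obtain ⟨g, hg, hfg, rfl⟩ := h
  obtain ⟨g', hg', hfg', rfl⟩ := h'
  refine ⟨g + g', hg.add hg', ?_, rfl⟩
  filter_upwards [Lp.coeFn_add f f', hfg, hfg'] with x h1 h2 h3
  rw [h1, Pi.add_apply, Pi.add_apply, h2, h3]

lemma HasTrace.smul {f : L2Half} {a : ℂ} (z : ℂ) (h : HasTrace f a) :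
    HasTrace (z • f) (z • a) := by
  obtain ⟨g, hg, hfg, rfl⟩ := h
  refine ⟨z • g, hg.const_smul z, ?_, rfl⟩
  filter_upwards [Lp.coeFn_smul z f, hfg] with x h1 h2
  rw [h1, Pi.smul_apply, Pi.smul_apply, h2]

lemma hasTrace_zero : HasTrace 0 0 :=
  ⟨0, continuousOn_const, Lp.coeFn_zero _ _ _, rfl⟩

/-- Boundary values are unique. -/
lemma HasTrace.unique {f : L2Half} {a a' : ℂ} (h : HasTrace f a) (h' : HasTrace f a') :
    a = a' := by
  obtain ⟨g, hg, hfg, rfl⟩ := h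
  obtain ⟨g', hg', hfg', rfl⟩ := h'
  have h1 : Set.EqOn g g' (Set.Ioi 0) :=
    Measure.eqOn_open_of_ae_eq (hfg.symm.trans hfg') isOpen_Ioi
      (hg.mono Set.Ioi_subset_Ici_self) (hg'.mono Set.Ioi_subset_Ici_self)
  have h2 : Set.EqOn g g' (Set.Ici 0) :=
    h1.of_subset_closure hg hg' Set.Ioi_subset_Ici_self (by rw [closure_Ioi])
  exact h2 Set.self_mem_Ici

/-- `u ∈ H²(𝒴)` with first derivative `d = (u_j')`, second derivative `s = (u_j'')`, and
vertex values `a j = u_j(0+)`, `b j = u_j'(0+)`. -/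
structure IsH2 (u d s : L2Y) (a b : Fin 3 → ℂ) : Prop where
  weakDeriv : ∀ j, IsWeakDeriv (u j) (d j)
  weakDeriv₂ : ∀ j, IsWeakDeriv (d j) (s j)
  trace : ∀ j, HasTrace (u j) (a j)
  trace₂ : ∀ j, HasTrace (d j) (b j)

/-- For a subspace `B` of vertex data `((u_j(0+))_j, (u_j'(0+))_j)`, the graph of the operator
`u ↦ (-c_j² u_j'')_j` on the functions `u ∈ H²(𝒴)` whose vertex data lie in `B`. -/
def junctionGraph (c : Fin 3 → ℝ) (B : Submodule ℂ ((Fin 3 → ℂ) × (Fin 3 → ℂ))) :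
    Submodule ℂ (L2Y × L2Y) where
  carrier := {p | ∃ (d s : L2Y) (a b : Fin 3 → ℂ), IsH2 p.1 d s a b ∧ (a, b) ∈ B ∧
    ∀ j, p.2 j = (-(c j : ℂ) ^ 2) • s j}
  zero_mem' := ⟨0, 0, 0, 0, ⟨fun _ => isWeakDeriv_zero, fun _ => isWeakDeriv_zero,
    fun _ => hasTrace_zero, fun _ => hasTrace_zero⟩, B.zero_mem, fun j => by simp⟩
  add_mem' := by
    rintro p q ⟨d, s, a, b, h, hB, e⟩ ⟨d', s', a', b', h', hB', e'⟩
    refine ⟨d + d', s + s', a + a', b + b',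
      ⟨fun j => (h.weakDeriv j).add (h'.weakDeriv j),
        fun j => (h.weakDeriv₂ j).add (h'.weakDeriv₂ j),
        fun j => (h.trace j).add (h'.trace j), fun j => (h.trace₂ j).add (h'.trace₂ j)⟩,
      B.add_mem hB hB', fun j => ?_⟩
    simp only [Prod.snd_add, PiLp.add_apply, e j, e' j, smul_add]
  smul_mem' := by
    rintro z p ⟨d, s, a, b, h, hB, e⟩
    refine ⟨z • d, z • s, z • a, z • b,
      ⟨fun j => (h.weakDeriv j).smul z, fun j => (h.weakDeriv₂ j).smul z,
        fun j => (h.trace j).smul z, fun j => (h.trace₂ j).smul z⟩,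
      B.smul_mem z hB, fun j => ?_⟩
    simp only [Prod.smul_snd, PiLp.smul_apply, e j]
    rw [smul_comm]

/-- The operator `diag (-c_j² d²/dx²)` on the functions in `H²(𝒴)` with vertex data in `B`. -/
def junctionOp (c : Fin 3 → ℝ) (B : Submodule ℂ ((Fin 3 → ℂ) × (Fin 3 → ℂ))) :
    L2Y →ₗ.[ℂ] L2Y :=
  (junctionGraph c B).toLinearPMap

lemma junctionOp_graph (c : Fin 3 → ℝ) (B : Submodule ℂ ((Fin 3 → ℂ) × (Fin 3 → ℂ))) :
    (junctionOp c B).graph = junctionGraph c B := by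
  refine Submodule.toLinearPMap_graph_eq _ ?_
  rintro ⟨u, w⟩ ⟨d, s, a, b, h, -, e⟩ rfl
  ext1 j
  have hd : d j = 0 := (h.weakDeriv j).unique isWeakDeriv_zero
  have hs : s j = 0 := (hd ▸ h.weakDeriv₂ j : IsWeakDeriv 0 (s j)).unique isWeakDeriv_zero
  rw [e j, hs, smul_zero]
  rfl

/-- Vertex data with `c₁ u₁' = c₂ u₂' = c₃ u₃' = 0` and `∑ c_j u_j = 0` at `0+`. -/
def minimalData (c : Fin 3 → ℝ) : Submodule ℂ ((Fin 3 → ℂ) × (Fin 3 → ℂ)) where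
  carrier := {p | (∀ j, (c j : ℂ) * p.2 j = 0) ∧ ∑ j, (c j : ℂ) * p.1 j = 0}
  zero_mem' := by simp
  add_mem' := by
    rintro p q ⟨h1, h2⟩ ⟨h3, h4⟩
    refine ⟨fun j => ?_, ?_⟩
    · simp [mul_add, h1 j, h3 j]
    · simp [mul_add, Finset.sum_add_distrib, h2, h4]
  smul_mem' := by
    rintro z p ⟨h1, h2⟩
    refine ⟨fun j => ?_, ?_⟩
    · simp only [Prod.smul_snd, Pi.smul_apply, smul_eq_mul, mul_left_comm, h1 j, mul_zero]
    · simp only [Prod.smul_fst, Pi.smul_apply, smul_eq_mul, mul_left_comm _ z, ← Finset.mul_sum,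
        h2, mul_zero]

/-- Vertex data with `c₁ u₁' = c₂ u₂' = c₃ u₃'` and `∑ c_j u_j = lam c₁ u₁'` at `0+`. -/
def deltaPrimeData (c : Fin 3 → ℝ) (lam : ℝ) : Submodule ℂ ((Fin 3 → ℂ) × (Fin 3 → ℂ)) where
  carrier := {p | (c 0 : ℂ) * p.2 0 = c 1 * p.2 1 ∧ (c 1 : ℂ) * p.2 1 = c 2 * p.2 2 ∧
    ∑ j, (c j : ℂ) * p.1 j = lam * (c 0 * p.2 0)}
  zero_mem' := by simp
  add_mem' := by
    rintro p q ⟨h1, h2, h3⟩ ⟨h4, h5, h6⟩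
    refine ⟨?_, ?_, ?_⟩
    · simp [mul_add, h1, h4]
    · simp [mul_add, h2, h5]
    · simp [mul_add, Finset.sum_add_distrib, h3, h6]
  smul_mem' := by
    rintro z p ⟨h1, h2, h3⟩
    refine ⟨?_, ?_, ?_⟩
    · simp only [Prod.smul_snd, Pi.smul_apply, smul_eq_mul, mul_left_comm _ z, h1]
    · simp only [Prod.smul_snd, Pi.smul_apply, smul_eq_mul, mul_left_comm _ z, h2]
    · simp only [Prod.smul_fst, Prod.smul_snd, Pi.smul_apply, smul_eq_mul, mul_left_comm _ z,
        ← Finset.mul_sum, h3]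

/-- Vertex data with `u₁' = u₂' = u₃' = 0` at `0+` (decoupled Neumann conditions). -/
def neumannData : Submodule ℂ ((Fin 3 → ℂ) × (Fin 3 → ℂ)) :=
  LinearMap.ker (LinearMap.snd ℂ (Fin 3 → ℂ) (Fin 3 → ℂ))

/-- The operator `𝒯`, with vanishing `δ'` vertex data. -/
def T (c : Fin 3 → ℝ) : L2Y →ₗ.[ℂ] L2Y := junctionOp c (minimalData c)

/-- The operator `𝒯_λ`, with `δ'` conditions of strength `lam` at the vertex. -/
def TLam (c : Fin 3 → ℝ) (lam : ℝ) : L2Y →ₗ.[ℂ] L2Y := junctionOp c (deltaPrimeData c lam)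

/-- The operator with Neumann conditions on each edge, which is the member `λ = ∞` of the
family of `δ'` conditions. -/
def TNeumann (c : Fin 3 → ℝ) : L2Y →ₗ.[ℂ] L2Y := junctionOp c neumannData

end YJunction

end

/-!
The operators are handled through their graphs and through the two boundary values
`l = ∑ c_j u_j(0+)` and `m = c_j u_j'(0+)` of a function all of whose fluxes agree
(`HasVertexData`). Integrating by parts on the three edges gives Green's identity
`⟪A u, v⟫ - ⟪u, A v⟫ = conj m * l' - conj l * m'` (`HasVertexData.green`), so everything about
self-adjointness is linear algebra in the boundary plane `ℂ²`, once the adjoint of `𝒯` is known to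
consist of such functions only (`mem_adjoint_graph_T_iff`).

On an edge, du Bois-Reymond's lemma shows that an `H¹` function is a primitive of its weak
derivative, whence boundary values and integration by parts. The Neumann problem
`u - c² u'' = f`, `u'(0) = 0` is solved by an orthogonal projection, so `𝒯_∞ + 1` is onto. As `𝒯` is
`𝒯_∞` restricted to `l = 0`, Green's identity against the solution
`g_j = -(sgn c_j) exp (-x / |c_j|)` of `𝒯* g = -g` turns this condition into
`⟪g, (𝒯_∞ + 1) u⟫ = 0`. Therefore `ker (𝒯* + 1)` is spanned by `g`, and
`D(𝒯*) = D(𝒯_∞) + span g`; no interpolation inequality for `u'` is needed. A self-adjoint extension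
corresponds to a Lagrangian line in the boundary plane, that is, to `l = λ m` with `λ` real or to
`m = 0`. The deficiency spaces are parametrized by `m`, since an element with `m = 0` would be an
eigenvector of `𝒯_∞` with a nonreal eigenvalue.

For the spectrum, `⟪u, 𝒯_λ u⟫ = ∑ c_j² ‖u_j'‖² + λ |m|²`. If `λ > 0`, this is nonnegative, and
`𝒯_λ - z` is bounded below for `z` off `[0, ∞)`. If `λ < 0`, the exponential with `k = κ`,
`κ = -∑ |c_j| / λ`, is an eigenfunction with the eigenvalue `-κ²`. The form is nonnegative on the
hyperplane `m = 0`, hence on the orthogonal complement of that eigenfunction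
(`exists_decomposition_TLam`). Bounded below self-adjoint operators are invertible
(`mem_resolventSet_of_bounded_below`). Finally `[0, ∞)` is in the spectrum because of approximate
eigenfunctions `x² exp ((iτ - ε) x)` with vanishing vertex data, and it contains no eigenvalues
because `u'' = -τ² u` factors into first order equations without square integrable solutions.
-/

noncomputable section

/-! ### Self-adjoint operators and their resolvents -/

namespace UnboundedOp

open ComplexConjugate InnerProductSpace

variable {E : Type*} [NormedAddCommGroup E] [InnerProductSpace ℂ E]

lemma adjoint_graph_eq_self [CompleteSpace E] {A : E →ₗ.[ℂ] E} (hA : IsSelfAdjoint A) :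
    A.graph.adjoint = A.graph := by
  rw [← LinearPMap.adjoint_graph_eq_graph_adjoint hA.dense_domain,
    LinearPMap.isSelfAdjoint_def.1 hA]

/-- Self-adjoint operators have no proper self-adjoint extensions. -/
lemma eq_of_graph_le_of_isSelfAdjoint [CompleteSpace E] {A B : E →ₗ.[ℂ] E}
    (hA : IsSelfAdjoint A) (hB : IsSelfAdjoint B) (h : A.graph ≤ B.graph) : A = B := by
  refine LinearPMap.eq_of_eq_graph (le_antisymm h ?_)
  rw [← adjoint_graph_eq_self hA, ← adjoint_graph_eq_self hB]
  intro p hp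
  rw [Submodule.mem_adjoint_iff] at hp ⊢
  exact fun a b hab => hp a b (h hab)

/-- If `A` is self-adjoint, `A - z` is bounded below and `conj z` is not an eigenvalue, then `z`
is in the resolvent set: the range of `A - z` is closed, and its orthogonal complement is the
kernel of `A - conj z`. -/
lemma mem_resolventSet_of_bounded_below [CompleteSpace E] {A : E →ₗ.[ℂ] E}
    (hA : IsSelfAdjoint A) {z : ℂ} {δ : ℝ} (hδ : 0 < δ)
    (hb : ∀ u w, (u, w) ∈ A.graph → δ * ‖u‖ ≤ ‖w - z • u‖)
    (hz : ∀ u, (u, conj z • u) ∈ A.graph → u = 0) : z ∈ resolventSet A := by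
  let F : E × E →L[ℂ] E :=
    ContinuousLinearMap.snd ℂ E E - z • ContinuousLinearMap.fst ℂ E E
  let L : A.graph →L[ℂ] E := F.comp A.graph.subtypeL
  have hL : ∀ p : A.graph, L p = (p : E × E).2 - z • (p : E × E).1 := fun p => rfl
  have hbL : ∀ p : A.graph, δ * ‖(p : E × E).1‖ ≤ ‖L p‖ := fun p => hb _ _ p.2
  have hanti : AntilipschitzWith (Real.toNNReal (δ⁻¹ + (1 + ‖z‖ * δ⁻¹))) L := by
    refine L.antilipschitz_of_bound fun p => ?_
    rw [Real.coe_toNNReal _ (by positivity)]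
    have h1 : ‖(p : E × E).1‖ ≤ δ⁻¹ * ‖L p‖ := by
      rw [le_inv_mul_iff₀ hδ]
      exact hbL p
    have h2 : ‖(p : E × E).2‖ ≤ (1 + ‖z‖ * δ⁻¹) * ‖L p‖ := by
      have : (p : E × E).2 = L p + z • (p : E × E).1 := by rw [hL]; abel
      calc ‖(p : E × E).2‖ ≤ ‖L p‖ + ‖z‖ * ‖(p : E × E).1‖ := by
            rw [this, ← norm_smul]
            exact norm_add_le _ _
        _ ≤ ‖L p‖ + ‖z‖ * (δ⁻¹ * ‖L p‖) := by gcongr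
        _ = _ := by ring
    have h3 : 0 ≤ δ⁻¹ * ‖L p‖ := by positivity
    have h4 : 0 ≤ (1 + ‖z‖ * δ⁻¹) * ‖L p‖ := by positivity
    rw [add_mul]
    exact (Prod.norm_def (p : E × E)).le.trans (max_le (by linarith) (by linarith))
  have hcl : IsClosed (A.graph : Set (E × E)) := hA.isClosed
  have : CompleteSpace A.graph := hcl.completeSpace_coe
  have hrange : IsClosed (Set.range L) := hanti.isClosed_range L.uniformContinuous
  have hsurj : Function.Surjective L := by
    let K : Submodule ℂ E := LinearMap.range (L : A.graph →ₗ[ℂ] E)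
    have hKc : IsClosed (K : Set E) := by
      rwa [LinearMap.coe_range]
    have : CompleteSpace K := hKc.completeSpace_coe
    have hK : K = ⊤ := by
      rw [← Submodule.orthogonal_eq_bot_iff, Submodule.eq_bot_iff]
      intro v hv
      refine hz v ?_
      rw [← adjoint_graph_eq_self hA, Submodule.mem_adjoint_iff]
      intro a b hab
      have h := hv (L ⟨(a, b), hab⟩) ⟨⟨(a, b), hab⟩, rfl⟩
      rw [hL, inner_sub_left, inner_smul_left] at h
      simpa [inner_smul_right] using h
    intro f
    have hf : f ∈ K := hK ▸ Submodule.mem_top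
    exact hf
  let e : A.graph ≃ₗ[ℂ] E := LinearEquiv.ofBijective (L : A.graph →ₗ[ℂ] E)
    ⟨hanti.injective, hsurj⟩
  have he : ∀ f, L (e.symm f) = f := fun f => e.apply_symm_apply f
  let R : E →L[ℂ] E := LinearMap.mkContinuous
    (LinearMap.fst ℂ E E ∘ₗ A.graph.subtype ∘ₗ (e.symm : E →ₗ[ℂ] A.graph)) δ⁻¹ fun f => by
      have := hbL (e.symm f)
      rw [he] at this
      rwa [le_inv_mul_iff₀ hδ]
  have hR : ∀ f, R f = (e.symm f : E × E).1 := fun f => rfl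
  refine ⟨R, fun f => ?_, fun u => ?_⟩
  · have hmem : (R f, f + z • R f) ∈ A.graph := by
      have h2 : (e.symm f : E × E).2 = f + z • R f := by
        have := he f
        rw [hL, sub_eq_iff_eq_add] at this
        exact this
      have h3 : (R f, f + z • R f) = (e.symm f : E × E) := Prod.ext rfl h2.symm
      rw [h3]
      exact (e.symm f).2
    have hf := LinearPMap.mem_domain_of_mem_graph hmem
    refine ⟨hf, ?_⟩
    rw [← (LinearPMap.image_iff hf).2 hmem, add_sub_cancel_right]
  · have : e.symm (A u - z • (u : E)) = ⟨(u, A u), A.mem_graph u⟩ := by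
      rw [LinearEquiv.symm_apply_eq]
      rfl
    rw [hR, this]

lemma bounded_below_of_mem_resolventSet {A : E →ₗ.[ℂ] E} {z : ℂ} (hz : z ∈ resolventSet A) :
    ∃ C : ℝ, 0 ≤ C ∧ ∀ u w, (u, w) ∈ A.graph → ‖u‖ ≤ C * ‖w - z • u‖ := by
  obtain ⟨R, -, hR⟩ := hz
  refine ⟨‖R‖, norm_nonneg _, fun u w h => ?_⟩
  obtain ⟨y, rfl, rfl⟩ := A.mem_graph_iff.1 h
  simpa [hR y] using R.le_opNorm (A y - z • (y : E))

/-- A complex number off the half-line `[0, ∞)` has a positive distance to it. -/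
lemma exists_pos_le_norm_sub {z : ℂ} (hz : z ∉ (fun t : ℝ => (t : ℂ)) '' Set.Ici 0) :
    ∃ δ > 0, ∀ t : ℝ, 0 ≤ t → δ ≤ ‖(t : ℂ) - z‖ := by
  by_cases him : z.im = 0
  · have hre : z.re < 0 := by
      by_contra h
      exact hz ⟨z.re, not_lt.1 h, Complex.ext rfl (by simp [him])⟩
    refine ⟨-z.re, by linarith, fun t ht => ?_⟩
    have := (le_abs_self _).trans (Complex.abs_re_le_norm ((t : ℂ) - z))
    simp only [Complex.sub_re, Complex.ofReal_re] at this
    linarith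
  · refine ⟨|z.im|, abs_pos.2 him, fun t _ => ?_⟩
    simpa using Complex.abs_im_le_norm ((t : ℂ) - z)

/-- A vector with nonnegative quadratic form is bounded by `w - z u`, with a constant depending
on `z` only. -/
lemma exists_pos_bounded_below_of_nonneg {z : ℂ}
    (hz : z ∉ (fun t : ℝ => (t : ℂ)) '' Set.Ici 0) :
    ∃ δ > 0, ∀ (u w : E) (q : ℝ), 0 ≤ q → ⟪u, w⟫_ℂ = q → δ * ‖u‖ ≤ ‖w - z • u‖ := by
  obtain ⟨δ, hδ, h⟩ := exists_pos_le_norm_sub hz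
  refine ⟨δ, hδ, fun u w q hq huw => ?_⟩
  rcases eq_or_ne u 0 with rfl | hu
  · simp
  have hu' : 0 < ‖u‖ := norm_pos_iff.2 hu
  have huC : ((‖u‖ : ℝ) : ℂ) ≠ 0 := Complex.ofReal_ne_zero.2 hu'.ne'
  have e1 : ⟪u, w - z • u⟫_ℂ = ((‖u‖ ^ 2 : ℝ) : ℂ) * (((q / ‖u‖ ^ 2 : ℝ) : ℂ) - z) := by
    rw [inner_sub_right, inner_smul_right, huw, inner_self_eq_norm_sq_to_K]
    push_cast
    change (q : ℂ) - z * ((‖u‖ : ℝ) : ℂ) ^ 2 = _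
    field_simp
  have h1 := h (q / ‖u‖ ^ 2) (by positivity)
  have h2 := norm_inner_le_norm (𝕜 := ℂ) u (w - z • u)
  rw [e1, norm_mul, Complex.norm_real, Real.norm_of_nonneg (by positivity)] at h2
  have h3 : ‖u‖ * (δ * ‖u‖) ≤ ‖u‖ * ‖w - z • u‖ := by
    refine le_trans ?_ h2
    calc ‖u‖ * (δ * ‖u‖) = ‖u‖ ^ 2 * δ := by ring
      _ ≤ _ := by gcongr
  exact le_of_mul_le_mul_left h3 hu'

end UnboundedOp

namespace YJunction

open Set Filter Topology ComplexConjugate InnerProductSpace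

/-! ### Absolutely continuous primitives on an interval -/

lemma locallyIntegrableOn_L2Half (f : L2Half) :
    LocallyIntegrableOn (fun x => f x) (Ioi (0 : ℝ)) volume := by
  rw [locallyIntegrableOn_iff isOpen_Ioi.isLocallyClosed]
  intro K hK hKc
  have h1 : MemLp (fun x => f x) 2 (volume.restrict K) :=
    (Lp.memLp f).mono_measure (Measure.restrict_mono hK le_rfl)
  have : IsFiniteMeasure (volume.restrict K) :=
    ⟨by simpa using hKc.measure_lt_top⟩
  exact h1.integrable (by norm_num)

lemma intervalIntegrable_L2Half (f : L2Half) {R : ℝ} (hR : 0 ≤ R) :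
    IntervalIntegrable (fun x => f x) volume 0 R := by
  rw [intervalIntegrable_iff_integrableOn_Ioc_of_le hR]
  have h1 : MemLp (fun x => f x) 2 (volume.restrict (Ioc 0 R)) :=
    (Lp.memLp f).mono_measure (Measure.restrict_mono (fun x hx => hx.1) le_rfl)
  exact h1.integrable (by norm_num)

lemma absolutelyContinuous_primitive {f : ℝ → ℂ} {R : ℝ}
    (hf : IntervalIntegrable f volume 0 R) (a : ℂ) :
    AbsolutelyContinuousOnInterval (fun x => a + ∫ t in (0 : ℝ)..x, f t) 0 R := by
  have hconst : ∀ z : ℂ, AbsolutelyContinuousOnInterval (fun _ : ℝ => z) 0 R := fun z =>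
    (LipschitzWith.const z).lipschitzOnWith.absolutelyContinuousOnInterval
  have hre : IntervalIntegrable (fun x => (f x).re) volume 0 R := ⟨hf.1.re, hf.2.re⟩
  have him : IntervalIntegrable (fun x => (f x).im) volume 0 R := ⟨hf.1.im, hf.2.im⟩
  have h1 := (hre.absolutelyContinuousOnInterval_intervalIntegral
    (c := 0) left_mem_uIcc).fun_smul (hconst 1)
  have h2 := (him.absolutelyContinuousOnInterval_intervalIntegral
    (c := 0) left_mem_uIcc).fun_smul (hconst Complex.I)
  have h3 := (hconst a).fun_add (h1.fun_add h2)
  have key : ∀ x ∈ uIcc 0 R, (a + ∫ t in (0 : ℝ)..x, f t) =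
      a + ((∫ t in (0 : ℝ)..x, (f t).re) • (1 : ℂ) +
        (∫ t in (0 : ℝ)..x, (f t).im) • Complex.I) := by
    intro x hx
    have hfx : IntervalIntegrable f volume 0 x :=
      hf.mono_set (uIcc_subset_uIcc left_mem_uIcc hx)
    congr 1
    have e1 : (∫ t in (0 : ℝ)..x, (f t).re) = (∫ t in (0 : ℝ)..x, f t).re :=
      (Complex.reCLM.intervalIntegral_comp_comm hfx)
    have e2 : (∫ t in (0 : ℝ)..x, (f t).im) = (∫ t in (0 : ℝ)..x, f t).im :=
      (Complex.imCLM.intervalIntegral_comp_comm hfx)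
    rw [e1, e2, Complex.real_smul, Complex.real_smul, mul_one, Complex.re_add_im]
  refine Tendsto.congr' ?_ h3
  filter_upwards [mem_inf_of_right (mem_principal_self _)] with E hE
  refine Finset.sum_congr rfl fun i hi => ?_
  have := hE.1 i hi
  rw [key _ this.1, key _ this.2]

/-- Integration by parts on `[0, R]` for primitives of integrable functions. -/
lemma integral_mul_primitive {f g : ℝ → ℂ} {R : ℝ} (hf : IntervalIntegrable f volume 0 R)
    (hg : IntervalIntegrable g volume 0 R) (a b : ℂ) :
    ∫ x in (0 : ℝ)..R, (f x * (b + ∫ t in (0 : ℝ)..x, g t) +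
        (a + ∫ t in (0 : ℝ)..x, f t) * g x) =
      (a + ∫ t in (0 : ℝ)..R, f t) * (b + ∫ t in (0 : ℝ)..R, g t) - a * b := by
  have hF := absolutelyContinuous_primitive hf a
  have hG := absolutelyContinuous_primitive hg b
  have hi : IntervalIntegrable (fun x => f x * (b + ∫ t in (0 : ℝ)..x, g t) +
        (a + ∫ t in (0 : ℝ)..x, f t) * g x) volume 0 R :=
    (hf.mul_continuousOn hG.continuousOn).add (hg.continuousOn_mul hF.continuousOn)
  have hP := absolutelyContinuous_primitive hi 0
  have hFG := (hF.fun_smul hG).fun_sub hP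
  obtain ⟨C, hC⟩ := hFG.const_of_ae_hasDerivAt_zero (by
    filter_upwards [hf.ae_hasDerivAt_integral, hg.ae_hasDerivAt_integral,
      hi.ae_hasDerivAt_integral] with x h1 h2 h3 hx
    have d1 := (h1 hx 0 left_mem_uIcc).const_add a
    have d2 := (h2 hx 0 left_mem_uIcc).const_add b
    have d3 := (h3 hx 0 left_mem_uIcc).const_add 0
    simpa [smul_eq_mul] using! (d1.mul d2).sub d3)
  have e0 := hC 0 left_mem_uIcc
  have e1 := hC R right_mem_uIcc
  simp only [intervalIntegral.integral_same, smul_eq_mul, add_zero, zero_add, sub_zero] at e0 e1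
  rw [← e0] at e1
  linear_combination -e1

/-! ### Weak derivatives and boundary values on the half-line -/

/-- The lemma of du Bois-Reymond: a locally integrable function on `(0, ∞)` with vanishing
distributional derivative is constant. -/
lemma ae_eq_const_of_integral_deriv_smul_eq_zero {h : ℝ → ℂ}
    (hloc : LocallyIntegrableOn h (Ioi (0 : ℝ)) volume)
    (h0 : ∀ φ : ℝ → ℝ, ContDiff ℝ ∞ φ → HasCompactSupport φ → tsupport φ ⊆ Ioi 0 →
      ∫ x, deriv φ x • h x = 0) :
    ∃ C : ℂ, ∀ᵐ x, x ∈ Ioi (0 : ℝ) → h x = C := by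
  have hint : ∀ φ : ℝ → ℝ, Continuous φ → HasCompactSupport φ → tsupport φ ⊆ Ioi 0 →
      Integrable (fun x => φ x • h x) := by
    intro φ hφ hc hs
    have hK : IntegrableOn h (tsupport φ) := by
      rw [locallyIntegrableOn_iff isOpen_Ioi.isLocallyClosed] at hloc
      exact hloc _ hs hc
    have h1 : IntegrableOn (fun x => φ x • h x) (tsupport φ) :=
      hK.continuousOn_smul hφ.continuousOn hc
    refine (integrableOn_iff_integrable_of_support_subset ?_).1 h1
    intro x hx
    refine subset_tsupport φ fun h => hx ?_
    simp [h]
  -- a test function of integral one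
  obtain ⟨η, hη, hηc, hηs, hη1⟩ : ∃ η : ℝ → ℝ, ContDiff ℝ ∞ η ∧ HasCompactSupport η ∧
      tsupport η ⊆ Ioi 0 ∧ ∫ x, η x = 1 := by
    let B : ContDiffBump (2 : ℝ) := ⟨1 / 2, 1, by norm_num, by norm_num⟩
    refine ⟨B.normed volume, B.contDiff_normed, B.hasCompactSupport_normed, ?_,
      B.integral_normed⟩
    rw [B.tsupport_normed_eq]
    intro x hx
    rw [Metric.mem_closedBall, Real.dist_eq, abs_le] at hx
    have : B.rOut = 1 := rfl
    rw [mem_Ioi]; linarith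
  refine ⟨∫ x, η x • h x, ?_⟩
  have hz := isOpen_Ioi.ae_eq_zero_of_integral_contDiff_smul_eq_zero
    (f := fun x => h x - ∫ x, η x • h x) (μ := volume) (U := Ioi (0 : ℝ))
    (hloc.sub ((locallyIntegrable_const _).locallyIntegrableOn _)) ?_
  · filter_upwards [hz] with x hx hx0
    exact sub_eq_zero.1 (hx hx0)
  intro φ hφ hc hs
  set I : ℝ := ∫ x, φ x with hI
  have hφi : Integrable φ := hφ.continuous.integrable_of_hasCompactSupport hc
  have hηi : Integrable η := hη.continuous.integrable_of_hasCompactSupport hηc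
  -- `φ - I η` is the derivative of a test function
  let θ : ℝ → ℝ := fun x => φ x - I * η x
  have hθ : ContDiff ℝ ∞ θ := hφ.sub (contDiff_const.mul hη)
  have hθi : Integrable θ := hφi.sub (hηi.const_mul I)
  have hθ0 : ∫ x, θ x = 0 := by
    rw [integral_sub hφi (hηi.const_mul I), integral_const_mul, hη1, mul_one, sub_self]
  let ψ : ℝ → ℝ := fun x => ∫ t in (0 : ℝ)..x, θ t
  have hψd : ∀ x, HasDerivAt ψ (θ x) x := fun x =>
    intervalIntegral.integral_hasDerivAt_right hθi.intervalIntegrable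
      hθ.continuous.stronglyMeasurable.stronglyMeasurableAtFilter hθ.continuous.continuousAt
  have hψ' : deriv ψ = θ := funext fun x => (hψd x).deriv
  have hψ : ContDiff ℝ ∞ ψ := by
    rw [contDiff_infty_iff_deriv, hψ']
    exact ⟨fun x => (hψd x).differentiableAt, hθ⟩
  have hcK : IsCompact (tsupport φ ∪ tsupport η) := hc.isCompact.union hηc
  have hKs : tsupport φ ∪ tsupport η ⊆ Ioi 0 := union_subset hs hηs
  obtain ⟨α, β, hα, hK⟩ : ∃ α β : ℝ, 0 < α ∧ tsupport φ ∪ tsupport η ⊆ Icc α β := by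
    rcases (tsupport φ ∪ tsupport η).eq_empty_or_nonempty with he | hne
    · exact ⟨1, 1, one_pos, by rw [he]; exact empty_subset _⟩
    · refine ⟨sInf (tsupport φ ∪ tsupport η), sSup (tsupport φ ∪ tsupport η),
        hKs (hcK.sInf_mem hne), fun x hx => ⟨csInf_le hcK.bddBelow hx, le_csSup hcK.bddAbove hx⟩⟩
  have hθz : ∀ x, x ∉ Icc α β → θ x = 0 := by
    intro x hx
    have h1 : φ x = 0 := image_eq_zero_of_notMem_tsupport fun h => hx (hK (Or.inl h))
    have h2 : η x = 0 := image_eq_zero_of_notMem_tsupport fun h => hx (hK (Or.inr h))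
    simp [θ, h1, h2]
  have hψz : ∀ x, x ∉ Icc α β → ψ x = 0 := by
    intro x hx
    rcases lt_or_ge x α with h | h
    · refine intervalIntegral.integral_zero_ae (Eventually.of_forall fun t ht => hθz t fun h' => ?_)
      rw [uIoc, mem_Ioc] at ht
      have := ht.2.trans (max_le hα.le h.le)
      rcases this.lt_or_eq with h2 | h2
      · exact absurd h'.1 (not_le.2 h2)
      · have := h2 ▸ ht.2
        rcases le_max_iff.1 this with h3 | h3 <;> linarith
    · have hxβ : β < x := by
        by_contra h3
        exact hx ⟨h, not_lt.1 h3⟩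
      change ∫ t in (0 : ℝ)..x, θ t = 0
      rw [intervalIntegral.integral_of_le (by linarith),
        setIntegral_eq_integral_of_forall_compl_eq_zero, hθ0]
      exact fun t ht => hθz t fun h' => ht ⟨hα.trans_le h'.1, h'.2.trans hxβ.le⟩
  have hψc : HasCompactSupport ψ := HasCompactSupport.intro isCompact_Icc hψz
  have hψs : tsupport ψ ⊆ Ioi 0 := by
    refine (closure_minimal (fun x hx => ?_) isClosed_Icc : tsupport ψ ⊆ Icc α β).trans
      fun x hx => hα.trans_le hx.1
    by_contra h
    exact hx (hψz x h)
  have h1 := h0 ψ hψ hψc hψs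
  rw [hψ'] at h1
  have h2 : ∀ x, θ x • h x = φ x • h x - I • (η x • h x) := fun x => by
    simp only [θ, sub_smul, mul_smul]
  have i1 := hint φ hφ.continuous hc hs
  have i2 := hint η hη.continuous hηc hηs
  simp only [h2] at h1
  rw [integral_sub i1 (i2.fun_smul I), integral_smul] at h1
  simp only [smul_sub]
  rw [integral_sub i1 (hφi.smul_const _), integral_smul_const]
  exact h1

/-- The primitive of `g` with value `a` at `0`. -/
def primitive (a : ℂ) (g : L2Half) (x : ℝ) : ℂ := a + ∫ t in (0 : ℝ)..x, g t

@[simp] lemma primitive_zero (a : ℂ) (g : L2Half) : primitive a g 0 = a := by simp [primitive]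

lemma continuousOn_primitive (a : ℂ) (g : L2Half) : ContinuousOn (primitive a g) (Ici 0) := by
  intro x hx
  have hx' : (0 : ℝ) ≤ x := hx
  have h := (absolutelyContinuous_primitive
    (intervalIntegrable_L2Half g (R := x + 1) (by linarith)) a).continuousOn
  rw [uIcc_of_le (by linarith)] at h
  refine (h x ⟨hx', by linarith⟩).mono_of_mem_nhdsWithin ?_
  rw [mem_nhdsWithin]
  exact ⟨Iio (x + 1), isOpen_Iio, by simp, fun y hy => ⟨hy.2, hy.1.le⟩⟩

lemma integral_deriv_smul_primitive (a : ℂ) (g : L2Half) {φ : ℝ → ℝ} (hφ : ContDiff ℝ ∞ φ)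
    (hc : HasCompactSupport φ) (hs : tsupport φ ⊆ Ioi 0) :
    ∫ x in Ioi (0 : ℝ), deriv φ x • primitive a g x = -∫ x in Ioi (0 : ℝ), φ x • g x := by
  obtain ⟨R, hR0, hR⟩ : ∃ R : ℝ, 0 ≤ R ∧ tsupport φ ⊆ Iic R := by
    obtain ⟨R, hR⟩ := hc.isCompact.bddAbove
    exact ⟨max R 0, le_max_right _ _, fun x hx => (hR hx).trans (le_max_left _ _)⟩
  have hd : Continuous (deriv φ) := hφ.continuous_deriv (by simp)
  have hφ0 : φ 0 = 0 := image_eq_zero_of_notMem_tsupport fun h => lt_irrefl (0 : ℝ) (hs h)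
  have hsR : ∀ x, R < x → φ x = 0 ∧ deriv φ x = 0 := fun x hx =>
    ⟨image_eq_zero_of_notMem_tsupport fun h => not_lt.2 (hR h) hx,
      image_eq_zero_of_notMem_tsupport fun h => not_lt.2 (hR (tsupport_deriv_subset h)) hx⟩
  have hφR : φ R = 0 := by
    have : Tendsto φ (𝓝[>] R) (𝓝 (φ R)) := hφ.continuous.continuousAt.mono_left nhdsWithin_le_nhds
    refine tendsto_nhds_unique this (tendsto_const_nhds.congr' ?_)
    filter_upwards [self_mem_nhdsWithin] with x hx
    exact (hsR x hx).1.symm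
  have hprim : ∀ x : ℝ, (∫ t in (0 : ℝ)..x, ((deriv φ t : ℝ) : ℂ)) = φ x := by
    intro x
    have hφd : Differentiable ℝ φ := hφ.differentiable (by simp)
    rw [intervalIntegral.integral_ofReal, intervalIntegral.integral_deriv_eq_sub
      (fun y _ => hφd y) (hd.intervalIntegrable _ _), hφ0, sub_zero]
  have key := integral_mul_primitive (R := R)
    (f := fun t => ((deriv φ t : ℝ) : ℂ)) (g := fun x => g x)
    ((Complex.continuous_ofReal.comp hd).intervalIntegrable _ _)
    (intervalIntegrable_L2Half g hR0) 0 a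
  simp only [hprim, zero_add, hφR, Complex.ofReal_zero, zero_mul, sub_zero] at key
  have i1 : IntervalIntegrable (fun x => ((deriv φ x : ℝ) : ℂ) * (a + ∫ t in (0 : ℝ)..x, g t))
      volume 0 R :=
    ((Complex.continuous_ofReal.comp hd).intervalIntegrable _ _).mul_continuousOn
      (absolutelyContinuous_primitive (intervalIntegrable_L2Half g hR0) a).continuousOn
  have i2 : IntervalIntegrable (fun x => (φ x : ℂ) * g x) volume 0 R :=
    (intervalIntegrable_L2Half g hR0).continuousOn_mul
      (Complex.continuous_ofReal.comp hφ.continuous).continuousOn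
  rw [intervalIntegral.integral_add i1 i2, intervalIntegral.integral_of_le hR0,
    intervalIntegral.integral_of_le hR0] at key
  have ext : ∀ u : ℝ → ℂ, (∀ x, R < x → u x = 0) →
      ∫ x in Ioi (0 : ℝ), u x = ∫ x in Ioc 0 R, u x := fun u hu =>
    (setIntegral_eq_of_subset_of_forall_sdiff_eq_zero measurableSet_Ioi
      (fun x hx => hx.1) fun x hx => hu x (not_le.1 fun h => hx.2 ⟨hx.1, h⟩))
  rw [ext _ fun x hx => by rw [(hsR x hx).2, zero_smul],
    ext _ fun x hx => by rw [(hsR x hx).1, zero_smul]]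
  simp only [Complex.real_smul, primitive]
  exact eq_neg_of_add_eq_zero_left key

/-- A function in `H¹(0, ∞)` is a primitive of its weak derivative. -/
lemma IsWeakDeriv.exists_ae_eq_primitive {f g : L2Half} (h : IsWeakDeriv f g) :
    ∃ a : ℂ, f =ᵐ[volume.restrict (Ioi (0 : ℝ))] primitive a g := by
  have hP : LocallyIntegrableOn (primitive 0 g) (Ioi (0 : ℝ)) volume :=
    ((continuousOn_primitive 0 g).mono Ioi_subset_Ici_self).locallyIntegrableOn measurableSet_Ioi
  obtain ⟨C, hC⟩ := ae_eq_const_of_integral_deriv_smul_eq_zero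
    ((locallyIntegrableOn_L2Half f).sub hP) (by
      intro φ hφ hc hs
      have hd : Continuous (deriv φ) := hφ.continuous_deriv (by simp)
      have hds : tsupport (deriv φ) ⊆ Ioi 0 := (tsupport_deriv_subset).trans hs
      have hz : ∀ x ∉ Ioi (0 : ℝ), deriv φ x = 0 := fun x hx =>
        image_eq_zero_of_notMem_tsupport fun h => hx (hds h)
      rw [← setIntegral_eq_integral_of_forall_compl_eq_zero (s := Ioi (0 : ℝ))
        (fun x hx => by rw [hz x hx, zero_smul])]
      have i1 := integrable_smul_test f hd hc.deriv
      have i2 : IntegrableOn (fun x => deriv φ x • primitive 0 g x) (Ioi 0) := by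
        refine IntegrableOn.of_forall_sdiff_eq_zero (s := tsupport (deriv φ)) ?_ measurableSet_Ioi
          fun x hx => by rw [image_eq_zero_of_notMem_tsupport hx.2, zero_smul]
        exact ContinuousOn.integrableOn_compact hc.deriv
          (hd.continuousOn.smul ((continuousOn_primitive 0 g).mono
            (hds.trans Ioi_subset_Ici_self)))
      simp only [Pi.sub_apply, smul_sub]
      rw [integral_sub i1 i2, h φ hφ hc hs, integral_deriv_smul_primitive 0 g hφ hc hs, sub_self])
  refine ⟨C, (ae_restrict_iff' measurableSet_Ioi).2 ?_⟩
  filter_upwards [hC] with x hx hx0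
  have := hx hx0
  simp only [Pi.sub_apply, primitive, zero_add] at this
  rw [primitive, ← this]
  ring

lemma IsWeakDeriv.exists_hasTrace {f g : L2Half} (h : IsWeakDeriv f g) :
    ∃ a : ℂ, HasTrace f a := by
  obtain ⟨a, ha⟩ := h.exists_ae_eq_primitive
  exact ⟨a, _, continuousOn_primitive a g, ha, primitive_zero a g⟩

lemma IsWeakDeriv.ae_eq_primitive {f g : L2Half} (h : IsWeakDeriv f g) {a : ℂ}
    (ha : HasTrace f a) : f =ᵐ[volume.restrict (Ioi (0 : ℝ))] primitive a g := by
  obtain ⟨a', ha'⟩ := h.exists_ae_eq_primitive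
  have : HasTrace f a' := ⟨_, continuousOn_primitive a' g, ha', primitive_zero a' g⟩
  rwa [ha.unique this]

lemma conj_primitive (a : ℂ) (g : L2Half) (x : ℝ) :
    conj (primitive a g x) = conj a + ∫ t in (0 : ℝ)..x, conj (g t) := by
  rw [primitive, map_add]
  congr 1
  simp only [intervalIntegral, map_sub, integral_conj]

/-- Integration by parts in `H¹(0, ∞)`. There is no contribution from infinity. -/
lemma IsWeakDeriv.inner_add_inner {f f' g g' : L2Half} {a b : ℂ} (hf : IsWeakDeriv f f')
    (hg : IsWeakDeriv g g') (ha : HasTrace f a) (hb : HasTrace g b) :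
    ⟪f', g⟫_ℂ + ⟪f, g'⟫_ℂ = -(conj a * b) := by
  have ef := hf.ae_eq_primitive ha
  have eg := hg.ae_eq_primitive hb
  have ipp : ∀ u v : L2Half, Integrable (fun x => conj (u x) * v x)
      (volume.restrict (Ioi (0 : ℝ))) := fun u v => by
    simpa [RCLike.inner_apply, mul_comm] using L2.integrable_inner (𝕜 := ℂ) u v
  have i0 : IntegrableOn (fun x => conj (primitive a f' x) * primitive b g' x) (Ioi 0) := by
    refine (ipp f g).congr ?_
    filter_upwards [ef, eg] with x h1 h2
    rw [h1, h2]
  have i1 : IntegrableOn (fun x => conj (f' x) * primitive b g' x +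
      conj (primitive a f' x) * g' x) (Ioi 0) := by
    refine ((ipp f' g).add (ipp f g')).congr ?_
    filter_upwards [ef, eg] with x h1 h2
    rw [Pi.add_apply, h1, h2]
  have hI : ⟪f', g⟫_ℂ + ⟪f, g'⟫_ℂ = ∫ x in Ioi (0 : ℝ), (conj (f' x) * primitive b g' x +
      conj (primitive a f' x) * g' x) := by
    rw [L2.inner_def, L2.inner_def,
      ← integral_add (L2.integrable_inner (𝕜 := ℂ) _ _) (L2.integrable_inner (𝕜 := ℂ) _ _)]
    refine integral_congr_ae ?_
    filter_upwards [ef, eg] with x h1 h2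
    rw [RCLike.inner_apply, RCLike.inner_apply, h1, h2]
    ring
  have hpart : ∀ R : ℝ, 0 ≤ R → ∫ x in (0 : ℝ)..R, (conj (f' x) * primitive b g' x +
      conj (primitive a f' x) * g' x) =
      conj (primitive a f' R) * primitive b g' R - conj a * b := by
    intro R hR
    have h1 := intervalIntegrable_L2Half f' hR
    have h1' : IntervalIntegrable (fun x => conj (f' x)) volume 0 R :=
      ⟨(LinearIsometryEquiv.integrable_comp_iff Complex.conjLIE).2 h1.1,
        (LinearIsometryEquiv.integrable_comp_iff Complex.conjLIE).2 h1.2⟩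
    have := integral_mul_primitive h1' (intervalIntegrable_L2Half g' hR) (conj a) b
    simp only [conj_primitive]
    exact this
  have hlim : Tendsto (fun R => conj (primitive a f' R) * primitive b g' R) atTop
      (𝓝 (⟪f', g⟫_ℂ + ⟪f, g'⟫_ℂ + conj a * b)) := by
    rw [hI]
    refine ((intervalIntegral_tendsto_integral_Ioi 0 i1 tendsto_id).add_const
      (conj a * b)).congr' ?_
    filter_upwards [eventually_ge_atTop 0] with R hR
    rw [id, hpart R hR, sub_add_cancel]
  have h0 := IntegrableAtFilter.eq_zero_of_tendsto (⟨Ioi 0, Ioi_mem_atTop _, i0⟩ :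
    IntegrableAtFilter _ atTop volume) (fun s hs => by
      rcases mem_atTop_sets.1 hs with ⟨b, hb⟩
      rw [← top_le_iff, ← Real.volume_Ici (a := b)]
      exact measure_mono hb) hlim
  exact eq_neg_of_add_eq_zero_left h0

lemma inner_toLp_eq_integral_smul (φ : ℝ → ℝ)
    (hm : MemLp (fun x => (φ x : ℂ)) 2 (volume.restrict (Ioi (0 : ℝ)))) (f : L2Half) :
    ⟪hm.toLp _, f⟫_ℂ = ∫ x in Ioi (0 : ℝ), φ x • f x := by
  rw [L2.inner_def]
  refine integral_congr_ae ?_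
  filter_upwards [hm.coeFn_toLp] with x hx
  rw [RCLike.inner_apply, hx]
  simp [mul_comm]

lemma memLp_ofReal_test {φ : ℝ → ℝ} (hφ : Continuous φ) (hc : HasCompactSupport φ) :
    MemLp (fun x => (φ x : ℂ)) 2 (volume.restrict (Ioi (0 : ℝ))) :=
  ((Complex.continuous_ofReal.comp hφ).memLp_of_hasCompactSupport
    (hc.comp_left Complex.ofReal_zero)).restrict _

/-- The pairs `(u, u')` with `u` in `H¹(0, ∞)` form a closed set. -/
lemma isClosed_isWeakDeriv : IsClosed {p : L2Half × L2Half | IsWeakDeriv p.1 p.2} := by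
  have hcont : ∀ φ : ℝ → ℝ, Continuous φ → HasCompactSupport φ →
      Continuous fun f : L2Half => ∫ x in Ioi (0 : ℝ), φ x • f x := by
    intro φ hφ hc
    simp only [← inner_toLp_eq_integral_smul φ (memLp_ofReal_test hφ hc)]
    fun_prop
  simp only [IsWeakDeriv, ofPred_forall]
  refine isClosed_iInter fun φ => isClosed_iInter fun hφ => isClosed_iInter fun hc =>
    isClosed_iInter fun _ => isClosed_eq ?_ ?_
  · exact (hcont _ (hφ.continuous_deriv (by simp)) hc.deriv).comp continuous_fst
  · exact ((hcont _ hφ.continuous hc).comp continuous_snd).neg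

/-- Classical derivatives are weak derivatives. -/
lemma isWeakDeriv_toLp {F F' : ℝ → ℂ} (hd : ∀ x, HasDerivAt F (F' x) x) (hF' : Continuous F')
    (hm : MemLp F 2 (volume.restrict (Ioi (0 : ℝ))))
    (hm' : MemLp F' 2 (volume.restrict (Ioi (0 : ℝ)))) :
    IsWeakDeriv (hm.toLp F) (hm'.toLp F') := by
  intro φ hφ hc hs
  have hF : Continuous F := continuous_iff_continuousAt.2 fun x => (hd x).continuousAt
  have hdφ : Continuous (deriv φ) := hφ.continuous_deriv (by simp)
  have hz : ∀ x ∉ Ioi (0 : ℝ), φ x = 0 := fun x hx =>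
    image_eq_zero_of_notMem_tsupport fun h => hx (hs h)
  have hz' : ∀ x ∉ Ioi (0 : ℝ), deriv φ x = 0 := fun x hx =>
    image_eq_zero_of_notMem_tsupport fun h => hx (hs (tsupport_deriv_subset h))
  have e1 : ∫ x in Ioi (0 : ℝ), deriv φ x • hm.toLp F x = ∫ x, ((deriv φ x : ℝ) : ℂ) * F x := by
    rw [← setIntegral_eq_integral_of_forall_compl_eq_zero (s := Ioi (0 : ℝ))
      (f := fun x => ((deriv φ x : ℝ) : ℂ) * F x)
      (fun x hx => by rw [hz' x hx, Complex.ofReal_zero, zero_mul])]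
    refine integral_congr_ae ?_
    filter_upwards [hm.coeFn_toLp] with x hx
    rw [hx, Complex.real_smul]
  have e2 : ∫ x in Ioi (0 : ℝ), φ x • hm'.toLp F' x = ∫ x, (φ x : ℂ) * F' x := by
    rw [← setIntegral_eq_integral_of_forall_compl_eq_zero (s := Ioi (0 : ℝ))
      (f := fun x => (φ x : ℂ) * F' x)
      (fun x hx => by rw [hz x hx, Complex.ofReal_zero, zero_mul])]
    refine integral_congr_ae ?_
    filter_upwards [hm'.coeFn_toLp] with x hx
    rw [hx, Complex.real_smul]
  have hi : ∀ (θ : ℝ → ℝ) (G : ℝ → ℂ), Continuous θ → HasCompactSupport θ → Continuous G →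
      Integrable (fun x => (θ x : ℂ) * G x) := fun θ G hθ hθc hG =>
    ((Complex.continuous_ofReal.comp hθ).mul hG).integrable_of_hasCompactSupport
      ((hθc.comp_left (g := Complex.ofReal) Complex.ofReal_zero).mul_right)
  rw [e1, e2, integral_mul_deriv_eq_deriv_mul_of_integrable (u' := fun x => ((deriv φ x : ℝ) : ℂ))
    (fun x _ => ((hφ.differentiable (by simp) x).hasDerivAt).ofReal_comp) (fun x _ => hd x)
    (hi _ _ hφ.continuous hc hF') (hi _ _ hdφ hc.deriv hF) (hi _ _ hφ.continuous hc hF), neg_neg]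

lemma hasTrace_toLp {F : ℝ → ℂ} (hF : Continuous F)
    (hm : MemLp F 2 (volume.restrict (Ioi (0 : ℝ)))) : HasTrace (hm.toLp F) (F 0) :=
  ⟨F, hF.continuousOn, hm.coeFn_toLp, rfl⟩

/-! ### Quadratic polynomials times exponentials -/

lemma norm_sq_pow_mul_exp (n : ℕ) (p : ℂ) {x : ℝ} :
    ‖(x : ℂ) ^ n * Complex.exp (p * x)‖ ^ 2 = x ^ (2 * n) * Real.exp (-(-2 * p.re * x)) := by
  rw [norm_mul, norm_pow, Complex.norm_exp, mul_pow, ← Real.exp_nat_mul, Complex.norm_real,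
    Real.norm_eq_abs, ← pow_mul, mul_comm n 2, pow_mul, sq_abs, ← pow_mul]
  congr 2
  simp
  ring

lemma integral_pow_mul_exp_neg_mul (n : ℕ) {s : ℝ} (hs : 0 < s) :
    ∫ x in Ioi (0 : ℝ), x ^ n * Real.exp (-(s * x)) = n.factorial / s ^ (n + 1) := by
  have h := Real.integral_rpow_mul_exp_neg_mul_Ioi (a := n + 1) (by positivity) hs
  rw [Real.Gamma_nat_eq_factorial, add_sub_cancel_right] at h
  simp only [Real.rpow_natCast] at h
  rw [h, ← Nat.cast_add_one, Real.rpow_natCast]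
  simp
  ring

lemma memLp_pow_mul_exp (n : ℕ) {p : ℂ} (hp : p.re < 0) :
    MemLp (fun x : ℝ => (x : ℂ) ^ n * Complex.exp (p * x)) 2
      (volume.restrict (Ioi (0 : ℝ))) := by
  have hc : Continuous (fun x : ℝ => (x : ℂ) ^ n * Complex.exp (p * x)) := by fun_prop
  rw [memLp_two_iff_integrable_sq_norm hc.aestronglyMeasurable]
  simp only [norm_sq_pow_mul_exp]
  refine Integrable.of_integral_ne_zero ?_
  rw [integral_pow_mul_exp_neg_mul _ (by linarith)]
  have : 0 < -2 * p.re := by linarith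
  positivity

/-- The function `x ↦ (α + β x + γ x²) exp (p x)`. -/
def expPolyFun (p α β γ : ℂ) (x : ℝ) : ℂ := (α + β * x + γ * x ^ 2) * Complex.exp (p * x)

lemma memLp_expPolyFun {p : ℂ} (hp : p.re < 0) (α β γ : ℂ) :
    MemLp (expPolyFun p α β γ) 2 (volume.restrict (Ioi (0 : ℝ))) := by
  have := (((memLp_pow_mul_exp 0 hp).const_mul α).add ((memLp_pow_mul_exp 1 hp).const_mul β)).add
    ((memLp_pow_mul_exp 2 hp).const_mul γ)
  refine this.ae_eq (Eventually.of_forall fun x => ?_)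
  simp only [Pi.add_apply, expPolyFun]
  ring

/-- The function `x ↦ (α + β x + γ x²) exp (p x)` as an element of `L²(0, ∞)`, for `Re p < 0`. -/
def expPoly {p : ℂ} (hp : p.re < 0) (α β γ : ℂ) : L2Half := (memLp_expPolyFun hp α β γ).toLp _

lemma isWeakDeriv_expPoly {p : ℂ} (hp : p.re < 0) (α β γ : ℂ) :
    IsWeakDeriv (expPoly hp α β γ) (expPoly hp (p * α + β) (p * β + 2 * γ) (p * γ)) := by
  refine isWeakDeriv_toLp (fun x => ?_) (by unfold expPolyFun; fun_prop) _ _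
  have h1 : HasDerivAt (fun x : ℝ => (x : ℂ)) 1 x := Complex.ofRealCLM.hasDerivAt
  have h2 := (((h1.const_mul β).const_add α).add ((h1.pow 2).const_mul γ)).mul
    (h1.const_mul p).cexp
  refine h2.congr_deriv ?_
  simp only [expPolyFun, Pi.add_apply, Pi.pow_apply]
  push_cast
  ring

lemma isWeakDeriv_expPoly_of_eq {p : ℂ} (hp : p.re < 0) {α β γ α' β' γ' : ℂ}
    (hα : α' = p * α + β) (hβ : β' = p * β + 2 * γ) (hγ : γ' = p * γ) :
    IsWeakDeriv (expPoly hp α β γ) (expPoly hp α' β' γ') := by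
  rw [hα, hβ, hγ]
  exact isWeakDeriv_expPoly hp α β γ

lemma hasTrace_expPoly {p : ℂ} (hp : p.re < 0) (α β γ : ℂ) :
    HasTrace (expPoly hp α β γ) α := by
  have := hasTrace_toLp (F := expPolyFun p α β γ) (by unfold expPolyFun; fun_prop)
    (memLp_expPolyFun hp α β γ)
  have h0 : expPolyFun p α β γ 0 = α := by simp [expPolyFun]
  rwa [h0] at this

lemma expPoly_add {p : ℂ} (hp : p.re < 0) (α β γ α' β' γ' : ℂ) :
    expPoly hp α β γ + expPoly hp α' β' γ' = expPoly hp (α + α') (β + β') (γ + γ') := by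
  rw [expPoly, expPoly, expPoly, ← MemLp.toLp_add]
  congr 1
  funext x
  simp only [Pi.add_apply, expPolyFun]
  ring

lemma smul_expPoly {p : ℂ} (hp : p.re < 0) (z α β γ : ℂ) :
    z • expPoly hp α β γ = expPoly hp (z * α) (z * β) (z * γ) := by
  rw [expPoly, expPoly, ← MemLp.toLp_const_smul]
  congr 1
  funext x
  simp only [Pi.smul_apply, expPolyFun, smul_eq_mul]
  ring

lemma norm_sq_toLp {F : ℝ → ℂ} (hm : MemLp F 2 (volume.restrict (Ioi (0 : ℝ)))) :
    ‖hm.toLp F‖ ^ 2 = ∫ x in Ioi (0 : ℝ), ‖F x‖ ^ 2 := by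
  have h := inner_self_eq_norm_sq_to_K (𝕜 := ℂ) (hm.toLp F)
  rw [L2.inner_def] at h
  have h2 : ∫ x in Ioi (0 : ℝ), ⟪hm.toLp F x, hm.toLp F x⟫_ℂ =
      ((∫ x in Ioi (0 : ℝ), ‖F x‖ ^ 2 : ℝ) : ℂ) := by
    rw [← integral_complex_ofReal]
    refine integral_congr_ae ?_
    filter_upwards [hm.coeFn_toLp] with x hx
    rw [hx, inner_self_eq_norm_sq_to_K]
    simp
  rw [h2] at h
  exact Complex.ofReal_injective ((Complex.ofReal_pow _ _).trans h.symm)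

lemma norm_sq_expPoly_one {p : ℂ} (hp : p.re < 0) :
    ‖expPoly hp 1 0 0‖ ^ 2 = 1 / (-2 * p.re) := by
  rw [expPoly, norm_sq_toLp]
  have h : ∀ x : ℝ, expPolyFun p 1 0 0 x = (x : ℂ) ^ 0 * Complex.exp (p * x) := fun x => by
    simp [expPolyFun]
  simp only [h, norm_sq_pow_mul_exp]
  rw [integral_pow_mul_exp_neg_mul _ (by linarith)]
  simp

lemma norm_sq_expPoly_X {p : ℂ} (hp : p.re < 0) :
    ‖expPoly hp 0 1 0‖ ^ 2 = 2 / (-2 * p.re) ^ 3 := by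
  rw [expPoly, norm_sq_toLp]
  have h : ∀ x : ℝ, expPolyFun p 0 1 0 x = (x : ℂ) ^ 1 * Complex.exp (p * x) := fun x => by
    simp [expPolyFun]
  simp only [h, norm_sq_pow_mul_exp]
  rw [integral_pow_mul_exp_neg_mul _ (by linarith)]
  simp [Nat.factorial]

lemma norm_sq_expPoly_X_sq {p : ℂ} (hp : p.re < 0) :
    ‖expPoly hp 0 0 1‖ ^ 2 = 24 / (-2 * p.re) ^ 5 := by
  rw [expPoly, norm_sq_toLp]
  have h : ∀ x : ℝ, expPolyFun p 0 0 1 x = (x : ℂ) ^ 2 * Complex.exp (p * x) := fun x => by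
    simp [expPolyFun]
  simp only [h, norm_sq_pow_mul_exp]
  rw [integral_pow_mul_exp_neg_mul _ (by linarith)]
  simp [Nat.factorial]

/-! ### A first order equation without square integrable solutions -/

/-- The solutions `C exp (κ x)` of `w' = κ w` are not square integrable when `Re κ ≥ 0`. -/
lemma IsWeakDeriv.eq_zero_of_eq_smul {w : L2Half} {κ : ℂ} (hκ : 0 ≤ κ.re)
    (h : IsWeakDeriv w (κ • w)) : w = 0 := by
  obtain ⟨a, ha⟩ := h.exists_hasTrace
  have hw := h.ae_eq_primitive ha
  set W := primitive a (κ • w) with hW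
  have hWc : ContinuousOn W (Ici 0) := continuousOn_primitive _ _
  have hκw : (κ • w : L2Half) =ᵐ[volume.restrict (Ioi (0 : ℝ))] fun x => κ * W x := by
    filter_upwards [Lp.coeFn_smul κ w, hw] with x h1 h2
    rw [h1, Pi.smul_apply, h2, smul_eq_mul]
  have hWi : ∀ x, 0 ≤ x → W x = a + ∫ t in (0 : ℝ)..x, κ * W t := by
    intro x hx
    rw [hW, primitive]
    congr 1
    rw [intervalIntegral.integral_of_le hx, intervalIntegral.integral_of_le hx]
    exact integral_congr_ae (ae_restrict_of_ae_restrict_of_subset (fun t ht => ht.1) hκw)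
  have hd : ∀ x ∈ Ioi (0 : ℝ), HasDerivAt W (κ * W x) x := by
    intro x hx
    have hx0 : (0 : ℝ) < x := hx
    have hcx : ContinuousOn (fun t => κ * W t) (Ioi 0) :=
      continuousOn_const.mul (hWc.mono Ioi_subset_Ici_self)
    have h1 : HasDerivAt (fun y => ∫ t in (0 : ℝ)..y, κ * W t) (κ * W x) x := by
      refine intervalIntegral.integral_hasDerivAt_right ?_
        (hcx.stronglyMeasurableAtFilter isOpen_Ioi x hx) (hcx.continuousAt (Ioi_mem_nhds hx0))
      refine (ContinuousOn.intervalIntegrable ?_)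
      rw [uIcc_of_le hx0.le]
      exact continuousOn_const.mul (hWc.mono Icc_subset_Ici_self)
    refine (h1.const_add a).congr_of_eventuallyEq ?_
    filter_upwards [Ioi_mem_nhds hx0] with y hy
    exact hWi y (le_of_lt hy)
  have hd2 : ∀ x ∈ Ioi (0 : ℝ), HasDerivAt (fun x : ℝ => W x * Complex.exp (-κ * x)) 0 x := by
    intro x hx
    have h1 : HasDerivAt (fun x : ℝ => (x : ℂ)) 1 x := Complex.ofRealCLM.hasDerivAt
    refine ((hd x hx).mul (h1.const_mul (-κ)).cexp).congr_deriv ?_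
    ring
  obtain ⟨C, hC⟩ : ∃ C, ∀ x ∈ Ioi (0 : ℝ), W x * Complex.exp (-κ * x) = C :=
    isOpen_Ioi.exists_is_const_of_deriv_eq_zero isPreconnected_Ioi
      (fun x hx => (hd2 x hx).differentiableAt.differentiableWithinAt) fun x hx => (hd2 x hx).deriv
  have hCW : ∀ x ∈ Ioi (0 : ℝ), W x = C * Complex.exp (κ * x) := by
    intro x hx
    rw [← hC x hx, mul_assoc, ← Complex.exp_add]
    simp
  have hC0 : C = 0 := by
    by_contra hne
    have hi : IntegrableOn (fun x => ‖w x‖ ^ 2) (Ioi 0) :=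
      (memLp_two_iff_integrable_sq_norm (Lp.aestronglyMeasurable w)).1 (Lp.memLp w)
    have hb : IntegrableOn (fun _ : ℝ => ‖C‖ ^ 2) (Ioi (0 : ℝ)) := by
      refine Integrable.mono hi aestronglyMeasurable_const ?_
      filter_upwards [hw, ae_restrict_mem measurableSet_Ioi] with x h1 hx
      have hx0 : (0 : ℝ) < x := hx
      rw [Real.norm_of_nonneg (by positivity), Real.norm_of_nonneg (by positivity), h1, hCW x hx,
        norm_mul, Complex.norm_exp]
      have : (1 : ℝ) ≤ Real.exp (κ * x).re := Real.one_le_exp (by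
        simpa using mul_nonneg hκ hx0.le)
      have h3 : ‖C‖ ≤ ‖C‖ * Real.exp (κ * x).re := le_mul_of_one_le_right (norm_nonneg _) this
      gcongr
    rw [integrableOn_const_iff] at hb
    simp [hne] at hb
  refine Lp.eq_zero_iff_ae_eq_zero.2 ?_
  filter_upwards [hw, ae_restrict_mem measurableSet_Ioi] with x h1 hx
  rw [h1, hCW x hx, hC0, zero_mul, Pi.zero_apply]

/-! ### The Neumann problem on the half-line -/

lemma isWeakDeriv_test {φ : ℝ → ℝ} (hφ : ContDiff ℝ ∞ φ) (hc : HasCompactSupport φ) :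
    IsWeakDeriv ((memLp_ofReal_test hφ.continuous hc).toLp _)
      ((memLp_ofReal_test (hφ.continuous_deriv (by simp)) hc.deriv).toLp _) := by
  have hφd : Differentiable ℝ φ := hφ.differentiable (by simp)
  exact isWeakDeriv_toLp (fun x => (hφd x).hasDerivAt.ofReal_comp)
    (Complex.continuous_ofReal.comp (hφ.continuous_deriv (by simp))) _ _

/-- The Neumann problem `u - c² u'' = f`, `u'(0) = 0` on the half-line. Its solution is the first
component of the orthogonal projection of `(f, 0)` onto the closed space of pairs `(u, c u')` with
`u ∈ H¹(0, ∞)`, that is, the weak solution provided by the Riesz representation theorem. -/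
lemma exists_neumann_solution {c : ℝ} (hc : c ≠ 0) (f : L2Half) :
    ∃ (u d s : L2Half), IsWeakDeriv u d ∧ IsWeakDeriv d s ∧ HasTrace d 0 ∧
      u - ((c : ℂ) ^ 2) • s = f := by
  have hcC : (c : ℂ) ≠ 0 := Complex.ofReal_ne_zero.2 hc
  let K : Submodule ℂ (WithLp 2 (L2Half × L2Half)) :=
    { carrier := {p | IsWeakDeriv p.fst ((c : ℂ)⁻¹ • p.snd)}
      zero_mem' := by simpa using isWeakDeriv_zero
      add_mem' := fun {p q} hp hq => by
        have := IsWeakDeriv.add hp hq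
        rwa [← smul_add] at this
      smul_mem' := fun z p hp => by
        have := IsWeakDeriv.smul z hp
        rwa [smul_comm] at this }
  have hK : IsClosed (K : Set (WithLp 2 (L2Half × L2Half))) := by
    have hcont : Continuous fun p : WithLp 2 (L2Half × L2Half) => (p.fst, (c : ℂ)⁻¹ • p.snd) := by
      fun_prop
    exact isClosed_isWeakDeriv.preimage hcont
  have : CompleteSpace K := hK.completeSpace_coe
  obtain ⟨y, hy, z, hz, hyz⟩ := K.exists_add_mem_mem_orthogonal (WithLp.toLp 2 (f, 0))
  have e1 : f = y.fst + z.fst := congrArg WithLp.fst hyz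
  have e2 : 0 = y.snd + z.snd := congrArg WithLp.snd hyz
  have hy' : IsWeakDeriv y.fst ((c : ℂ)⁻¹ • y.snd) := hy
  set u := y.fst with hu
  set d := (c : ℂ)⁻¹ • y.snd with hd
  have hz1 : z.fst = f - u := by rw [e1]; abel
  have hz2 : z.snd = -((c : ℂ) • d) := by
    rw [hd, smul_smul, mul_inv_cancel₀ hcC, one_smul]
    exact eq_neg_of_add_eq_zero_right e2.symm
  clear_value d
  have horth : ∀ φ φ' : L2Half, IsWeakDeriv φ φ' → ⟪φ, f - u⟫_ℂ = (c : ℂ) ^ 2 * ⟪φ', d⟫_ℂ := by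
    intro φ φ' h
    have hmem : WithLp.toLp 2 (φ, (c : ℂ) • φ') ∈ K := by
      change IsWeakDeriv φ ((c : ℂ)⁻¹ • (c : ℂ) • φ')
      rwa [smul_smul, inv_mul_cancel₀ hcC, one_smul]
    have h0 := hz _ hmem
    rw [WithLp.prod_inner_apply] at h0
    change ⟪φ, z.fst⟫_ℂ + ⟪(c : ℂ) • φ', z.snd⟫_ℂ = 0 at h0
    rw [hz1, hz2, inner_neg_right, inner_smul_left, inner_smul_right, Complex.conj_ofReal] at h0
    linear_combination h0
  have hds : IsWeakDeriv d (-((c : ℂ) ^ 2)⁻¹ • (f - u)) := by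
    intro φ hφ hcφ hs
    have h := horth _ _ (isWeakDeriv_test hφ hcφ)
    rw [← inner_toLp_eq_integral_smul _
        (memLp_ofReal_test (hφ.continuous_deriv (by simp)) hcφ.deriv),
      ← inner_toLp_eq_integral_smul _ (memLp_ofReal_test hφ.continuous hcφ), inner_smul_right, h]
    field_simp
  refine ⟨u, d, _, hy', hds, ?_, ?_⟩
  · obtain ⟨b, hb⟩ := hds.exists_hasTrace
    have hp : (-1 : ℂ).re < 0 := by simp
    have h1 := (isWeakDeriv_expPoly hp 1 0 0).inner_add_inner hds (hasTrace_expPoly hp 1 0 0) hb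
    have h2 := horth _ _ (isWeakDeriv_expPoly hp 1 0 0)
    rw [inner_smul_right, h2] at h1
    have hb0 : b = 0 := by
      have h3 : ∀ X : ℂ, X + -((c : ℂ) ^ 2)⁻¹ * ((c : ℂ) ^ 2 * X) = 0 := fun X => by
        field_simp
        ring
      rw [h3, map_one, one_mul] at h1
      exact neg_eq_zero.1 h1.symm
    rwa [hb0] at hb
  · rw [smul_smul, mul_neg, mul_inv_cancel₀ (pow_ne_zero 2 hcC), neg_one_smul]
    abel

/-- A square integrable function on `(0, ∞)` that is orthogonal to all test functions vanishes. -/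
lemma eq_zero_of_inner_test_eq_zero {f : L2Half}
    (h : ∀ (φ : ℝ → ℝ) (hφ : ContDiff ℝ ∞ φ) (hc : HasCompactSupport φ), tsupport φ ⊆ Ioi 0 →
      ⟪(memLp_ofReal_test hφ.continuous hc).toLp _, f⟫_ℂ = 0) : f = 0 := by
  have hz := isOpen_Ioi.ae_eq_zero_of_integral_contDiff_smul_eq_zero
    (locallyIntegrableOn_L2Half f) (by
      intro φ hφ hc hs
      have h1 := h φ hφ hc hs
      rw [inner_toLp_eq_integral_smul, setIntegral_eq_integral_of_forall_compl_eq_zero] at h1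
      · exact h1
      · intro x hx
        rw [image_eq_zero_of_notMem_tsupport (fun h => hx (hs h)), zero_smul])
  exact Lp.eq_zero_iff_ae_eq_zero.2 ((ae_restrict_iff' measurableSet_Ioi).2 hz)

/-! ### Functions on the junction with equal fluxes -/

/-- The pair `p = (u, (-c_j² u_j'')_j)`, where `u ∈ H²(𝒴)` has the first derivative `d`, all
fluxes `c_j u_j'(0+)` are equal to `m`, and `∑ c_j u_j(0+) = l`. These are the elements of the graph
of the adjoint of `𝒯`, and `(l, m)` are their boundary values. -/
def HasVertexData (c : Fin 3 → ℝ) (p : L2Y × L2Y) (d : L2Y) (l m : ℂ) : Prop :=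
  ∃ (s : L2Y) (a b : Fin 3 → ℂ), IsH2 p.1 d s a b ∧ (∀ j, p.2 j = (-(c j : ℂ) ^ 2) • s j) ∧
    (∀ j, (c j : ℂ) * b j = m) ∧ ∑ j, (c j : ℂ) * a j = l

variable {c : Fin 3 → ℝ}

lemma HasVertexData.add {p q d e : L2Y} {p₂ q₂ : L2Y} {l m l' m' : ℂ}
    (h : HasVertexData c (p, p₂) d l m) (h' : HasVertexData c (q, q₂) e l' m') :
    HasVertexData c (p + q, p₂ + q₂) (d + e) (l + l') (m + m') := by
  obtain ⟨s, a, b, h, e1, e2, e3⟩ := h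
  obtain ⟨s', a', b', h', e1', e2', e3'⟩ := h'
  refine ⟨s + s', a + a', b + b', ⟨fun j => (h.weakDeriv j).add (h'.weakDeriv j),
        fun j => (h.weakDeriv₂ j).add (h'.weakDeriv₂ j),
        fun j => (h.trace j).add (h'.trace j), fun j => (h.trace₂ j).add (h'.trace₂ j)⟩,
        fun j => ?_, fun j => ?_, ?_⟩
  · simp only [PiLp.add_apply, smul_add] at e1 e1' ⊢
    rw [e1 j, e1' j]
  · rw [Pi.add_apply, mul_add, e2, e2']
  · simp only [Pi.add_apply, mul_add, Finset.sum_add_distrib, e3, e3']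

lemma HasVertexData.smul {p p₂ d : L2Y} {l m : ℂ} (z : ℂ)
    (h : HasVertexData c (p, p₂) d l m) :
    HasVertexData c (z • p, z • p₂) (z • d) (z * l) (z * m) := by
  obtain ⟨s, a, b, h, e1, e2, e3⟩ := h
  refine ⟨z • s, z • a, z • b, ⟨fun j => (h.weakDeriv j).smul z, fun j => (h.weakDeriv₂ j).smul z,
        fun j => (h.trace j).smul z, fun j => (h.trace₂ j).smul z⟩, fun j => ?_, fun j => ?_, ?_⟩
  · simp only [PiLp.smul_apply] at e1 ⊢
    rw [e1 j, smul_comm]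
  · rw [Pi.smul_apply, smul_eq_mul, mul_left_comm, e2]
  · simp only [Pi.smul_apply, smul_eq_mul, mul_left_comm _ z, ← Finset.mul_sum, e3]

lemma HasVertexData.sub {p q d e : L2Y} {p₂ q₂ : L2Y} {l m l' m' : ℂ}
    (h : HasVertexData c (p, p₂) d l m) (h' : HasVertexData c (q, q₂) e l' m') :
    HasVertexData c (p - q, p₂ - q₂) (d - e) (l - l') (m - m') := by
  simpa [sub_eq_add_neg] using h.add (h'.smul (-1))

lemma HasVertexData.unique {p p₂ q₂ d e : L2Y} {l m l' m' : ℂ}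
    (h : HasVertexData c (p, p₂) d l m) (h' : HasVertexData c (p, q₂) e l' m') :
    l = l' ∧ m = m' := by
  obtain ⟨s, a, b, h, e1, e2, e3⟩ := h
  obtain ⟨s', a', b', h', e1', e2', e3'⟩ := h'
  have ha : a = a' := funext fun j => (h.trace j).unique (h'.trace j)
  have hd : d = e := by
    ext1 j
    exact (h.weakDeriv j).unique (h'.weakDeriv j)
  subst ha hd
  have hb : b 0 = b' 0 := (h.trace₂ 0).unique (h'.trace₂ 0)
  exact ⟨e3.symm.trans e3', by rw [← e2 0, hb, e2' 0]⟩

lemma HasVertexData.ne_zero {p p₂ d : L2Y} {l : ℂ} (h : HasVertexData c (p, p₂) d l 1) :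
    p ≠ 0 := by
  rintro rfl
  have h0 : HasVertexData c (0, 0) 0 0 0 := by
    simpa using h.smul 0
  exact one_ne_zero (h.unique h0).2

/-- The quadratic form of the operator. -/
lemma HasVertexData.inner_right {p q : L2Y × L2Y} {d e : L2Y} {l m l' m' : ℂ}
    (h : HasVertexData c p d l m) (h' : HasVertexData c q e l' m') :
    ⟪p.1, q.2⟫_ℂ = ∑ j, (c j : ℂ) ^ 2 * ⟪d j, e j⟫_ℂ + conj l * m' := by
  obtain ⟨s, a, b, h, e1, e2, e3⟩ := h
  obtain ⟨s', a', b', h', e1', e2', e3'⟩ := h'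
  have key : ∀ j, ⟪p.1 j, q.2 j⟫_ℂ =
      (c j : ℂ) ^ 2 * ⟪d j, e j⟫_ℂ + conj ((c j : ℂ) * a j) * m' := by
    intro j
    have h1 := (h.weakDeriv j).inner_add_inner (h'.weakDeriv₂ j) (h.trace j) (h'.trace₂ j)
    rw [e1' j, inner_smul_right, ← e2' j, map_mul, Complex.conj_ofReal]
    linear_combination (-(c j : ℂ) ^ 2) * h1
  rw [PiLp.inner_apply, Finset.sum_congr rfl fun j _ => key j, Finset.sum_add_distrib,
    ← Finset.sum_mul, ← map_sum, e3]

/-- Green's identity: the boundary form of the junction. -/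
lemma HasVertexData.green {p q : L2Y × L2Y} {d e : L2Y} {l m l' m' : ℂ}
    (h : HasVertexData c p d l m) (h' : HasVertexData c q e l' m') :
    ⟪p.2, q.1⟫_ℂ - ⟪p.1, q.2⟫_ℂ = conj m * l' - conj l * m' := by
  have h1 : ⟪p.2, q.1⟫_ℂ = ∑ j, (c j : ℂ) ^ 2 * ⟪d j, e j⟫_ℂ + conj m * l' := by
    rw [← inner_conj_symm, h'.inner_right h]
    simp only [map_add, map_sum, map_mul, map_pow, Complex.conj_ofReal, inner_conj_symm,
      Complex.conj_conj]
    ring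
  rw [h1, h.inner_right h']
  ring

lemma mem_graph_T_iff {p : L2Y × L2Y} :
    p ∈ (T c).graph ↔ ∃ d, HasVertexData c p d 0 0 := by
  rw [T, junctionOp_graph]
  constructor
  · rintro ⟨d, s, a, b, h, ⟨h1, h2⟩, e⟩
    exact ⟨d, s, a, b, h, e, h1, h2⟩
  · rintro ⟨d, s, a, b, h, e, h1, h2⟩
    exact ⟨d, s, a, b, h, ⟨h1, h2⟩, e⟩

lemma mem_graph_TLam_iff {lam : ℝ} {p : L2Y × L2Y} :
    p ∈ (TLam c lam).graph ↔ ∃ d l m, HasVertexData c p d l m ∧ l = lam * m := by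
  rw [TLam, junctionOp_graph]
  constructor
  · rintro ⟨d, s, a, b, h, ⟨h1, h2, h3⟩, e⟩
    refine ⟨d, _, (c 0 : ℂ) * b 0, ⟨s, a, b, h, e, fun j => ?_, rfl⟩, h3⟩
    fin_cases j
    exacts [rfl, h1.symm, (h1.trans h2).symm]
  · rintro ⟨d, l, m, ⟨s, a, b, h, e, h1, h2⟩, hl⟩
    exact ⟨d, s, a, b, h, ⟨(h1 0).trans (h1 1).symm, (h1 1).trans (h1 2).symm,
      by rw [h2, hl]; exact congrArg _ (h1 0).symm⟩, e⟩

lemma mem_graph_TNeumann_iff (hc : ∀ j, c j ≠ 0) {p : L2Y × L2Y} :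
    p ∈ (TNeumann c).graph ↔ ∃ d l m, HasVertexData c p d l m ∧ m = 0 := by
  rw [TNeumann, junctionOp_graph]
  constructor
  · rintro ⟨d, s, a, b, h, hb, e⟩
    have hb0 : b = 0 := hb
    exact ⟨d, _, 0, ⟨s, a, b, h, e, fun j => by simp [hb0], rfl⟩, rfl⟩
  · rintro ⟨d, l, m, ⟨s, a, b, h, e, h1, h2⟩, hm⟩
    refine ⟨d, s, a, b, h, ?_, e⟩
    change b = 0
    funext j
    have := h1 j
    rw [hm] at this
    exact (mul_eq_zero.1 this).resolve_left (Complex.ofReal_ne_zero.2 (hc j))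

/-! ### Explicit functions on the junction -/

/-- The exponentials `u_j = -(sgn c_j / k) exp (-k x / |c_j|)` have the flux `1` through the vertex
and satisfy `-c_j² u_j'' = -k² u_j`. -/
lemma exists_exponential (hc : ∀ j, c j ≠ 0) {k : ℂ} (hk : 0 < k.re) :
    ∃ u d : L2Y, HasVertexData c (u, (-k ^ 2) • u) d (-(∑ j, (|c j| : ℝ) : ℝ) / k) 1 := by
  have hk0 : k ≠ 0 := fun h => by simp [h] at hk
  have hre : ∀ j, (((-1 / |c j| : ℝ) : ℂ) * k).re < 0 := fun j => by
    rw [Complex.re_ofReal_mul]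
    have : 0 < |c j| := abs_pos.2 (hc j)
    exact mul_neg_of_neg_of_pos (div_neg_of_neg_of_pos (by norm_num) this) hk
  have hsc : ∀ j, (c j : ℂ) ^ 2 = ((|c j| : ℝ) : ℂ) ^ 2 := fun j => by
    rw [← Complex.ofReal_pow, ← Complex.ofReal_pow, sq_abs]
  have habs : ∀ j, ((|c j| : ℝ) : ℂ) ≠ 0 := fun j => Complex.ofReal_ne_zero.2 (abs_ne_zero.2 (hc j))
  have hcC : ∀ j, (c j : ℂ) ≠ 0 := fun j => Complex.ofReal_ne_zero.2 (hc j)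
  let a : Fin 3 → ℂ := fun j => -((|c j| : ℝ) : ℂ) / (c j * k)
  let q : Fin 3 → ℂ := fun j => ((-1 / |c j| : ℝ) : ℂ) * k
  have hq : ∀ j, q j = -k / ((|c j| : ℝ) : ℂ) := fun j => by
    simp only [q]; push_cast; ring
  refine ⟨WithLp.toLp 2 fun j => expPoly (hre j) (a j) 0 0,
    WithLp.toLp 2 fun j => expPoly (hre j) (q j * a j) 0 0,
    WithLp.toLp 2 fun j => expPoly (hre j) (q j * (q j * a j)) 0 0, a, fun j => q j * a j,
    ⟨fun j => ?_, fun j => ?_, fun j => hasTrace_expPoly (hre j) _ _ _,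
      fun j => hasTrace_expPoly (hre j) _ _ _⟩, fun j => ?_, fun j => ?_, ?_⟩
  · exact isWeakDeriv_expPoly_of_eq (hre j) (by simp [q]) (by simp) (by simp)
  · exact isWeakDeriv_expPoly_of_eq (hre j) (by simp [q]) (by simp) (by simp)
  · simp only [PiLp.smul_apply, smul_expPoly, mul_zero]
    congr 1
    rw [hq, hsc]
    field_simp [habs j]
  · simp only [hq, a]
    field_simp [habs j, hcC j]
  · simp only [a]
    push_cast
    rw [neg_div, Finset.sum_div, ← Finset.sum_neg_distrib]
    refine Finset.sum_congr rfl fun j _ => ?_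
    field_simp [hcC j]

/-- All boundary values occur, for instance among the functions
`u_j = (a_j + (a_j + b_j) x) exp (-x)`. -/
lemma exists_hasVertexData (hc : ∀ j, c j ≠ 0) (l m : ℂ) :
    ∃ p d, HasVertexData c p d l m := by
  have hp : (-1 : ℂ).re < 0 := by simp
  have hcC : ∀ j, (c j : ℂ) ≠ 0 := fun j => Complex.ofReal_ne_zero.2 (hc j)
  let a : Fin 3 → ℂ := fun j => l / (3 * c j)
  let b : Fin 3 → ℂ := fun j => m / c j
  let s : L2Y := WithLp.toLp 2 fun j => expPoly hp (-(2 * b j) - a j) (a j + b j) 0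
  refine ⟨(WithLp.toLp 2 fun j => expPoly hp (a j) (a j + b j) 0,
    WithLp.toLp 2 fun j => (-(c j : ℂ) ^ 2) • s j),
    WithLp.toLp 2 fun j => expPoly hp (b j) (-(a j + b j)) 0, s, a, b,
    ⟨fun j => ?_, fun j => ?_, fun j => hasTrace_expPoly hp _ _ _,
      fun j => hasTrace_expPoly hp _ _ _⟩, fun j => rfl, fun j => ?_, ?_⟩
  · exact isWeakDeriv_expPoly_of_eq hp (by ring) (by ring) (by ring)
  · exact isWeakDeriv_expPoly_of_eq hp (by ring) (by ring) (by ring)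
  · exact mul_div_cancel₀ _ (hcC j)
  · have : ∀ j, (c j : ℂ) * a j = l / 3 := fun j => by
      simp only [a]
      field_simp [hcC j]
    simp [this]
    ring

/-- The operator `𝒯_∞ + 1` is onto. -/
lemma exists_neumann_solution_junction (hc : ∀ j, c j ≠ 0) (f : L2Y) :
    ∃ u w d l, HasVertexData c (u, w) d l 0 ∧ w + u = f := by
  choose u d s h1 h2 h3 h4 using fun j => exists_neumann_solution (hc j) (f j)
  choose a ha using fun j => (h1 j).exists_hasTrace
  refine ⟨WithLp.toLp 2 u, WithLp.toLp 2 fun j => (-(c j : ℂ) ^ 2) • s j, WithLp.toLp 2 d, _,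
    ⟨WithLp.toLp 2 s, a, 0, ⟨h1, h2, ha, h3⟩, fun j => rfl, fun j => by simp, rfl⟩, ?_⟩
  ext1 j
  rw [← h4 j, PiLp.add_apply]
  change (-(c j : ℂ) ^ 2) • s j + u j = _
  rw [neg_smul]
  abel

/-- The domain of `𝒯` contains the test functions on each edge. -/
lemma dense_domain_T (c : Fin 3 → ℝ) : Dense ((T c).domain : Set L2Y) := by
  rw [Submodule.dense_iff_topologicalClosure_eq_top, Submodule.topologicalClosure_eq_top_iff,
    Submodule.eq_bot_iff]
  intro v hv
  ext1 j
  refine eq_zero_of_inner_test_eq_zero fun φ hφ hc hs => ?_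
  have e0 : φ 0 = 0 := image_eq_zero_of_notMem_tsupport fun h => lt_irrefl (0 : ℝ) (hs h)
  have e1 : deriv φ 0 = 0 := image_eq_zero_of_notMem_tsupport fun h =>
    lt_irrefl (0 : ℝ) (hs (tsupport_deriv_subset h))
  have hd : ContDiff ℝ ∞ (deriv φ) := (contDiff_infty_iff_deriv.1 hφ).2
  have hdd : ContDiff ℝ ∞ (deriv (deriv φ)) := (contDiff_infty_iff_deriv.1 hd).2
  have t0 := hasTrace_toLp (Complex.continuous_ofReal.comp hφ.continuous)
    (memLp_ofReal_test hφ.continuous hc)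
  have t1 := hasTrace_toLp (Complex.continuous_ofReal.comp hd.continuous)
    (memLp_ofReal_test hd.continuous hc.deriv)
  simp only [Function.comp, e0, e1, Complex.ofReal_zero] at t0 t1
  let E : L2Half → L2Y := fun f => WithLp.toLp 2 (Pi.single j f)
  have hE : ∀ (f : L2Half) (i), E f i = if i = j then f else 0 := fun f i => by
    simp [E, Pi.single_apply]
  have hmem : E ((memLp_ofReal_test hφ.continuous hc).toLp _) ∈ (T c).domain := by
    refine LinearPMap.mem_domain_iff.2 ⟨WithLp.toLp 2 fun i => (-(c i : ℂ) ^ 2) •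
      E ((memLp_ofReal_test hdd.continuous hc.deriv.deriv).toLp _) i, mem_graph_T_iff.2
      ⟨E ((memLp_ofReal_test hd.continuous hc.deriv).toLp _), _, 0, 0,
      ⟨fun i => ?_, fun i => ?_, fun i => ?_, fun i => ?_⟩, fun i => rfl, by simp, by simp⟩⟩
    · rw [hE, hE]
      split_ifs
      exacts [isWeakDeriv_test hφ hc, isWeakDeriv_zero]
    · rw [hE, hE]
      split_ifs
      exacts [isWeakDeriv_test hd hc.deriv, isWeakDeriv_zero]
    · rw [hE]
      split_ifs
      exacts [t0, hasTrace_zero]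
    · rw [hE]
      split_ifs
      exacts [t1, hasTrace_zero]
  have h := hv _ hmem
  rw [PiLp.inner_apply, Finset.sum_eq_single j
    (fun i _ hij => by rw [hE, if_neg hij, inner_zero_left]) (by simp), hE, if_pos rfl] at h
  exact h

/-! ### The adjoint and the self-adjoint extensions -/

lemma sum_abs_pos (hc : ∀ j, c j ≠ 0) : 0 < ∑ j, |c j| :=
  Finset.sum_pos (fun j _ => abs_pos.2 (hc j)) Finset.univ_nonempty

lemma HasVertexData.mem_adjoint_graph_T {p : L2Y × L2Y} {d : L2Y} {l m : ℂ}
    (h : HasVertexData c p d l m) : p ∈ (T c).graph.adjoint := by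
  rw [Submodule.mem_adjoint_iff]
  intro x y hxy
  obtain ⟨e, he⟩ := mem_graph_T_iff.1 hxy
  simpa using he.green h

/-- Every element `(v, w)` of the graph of `𝒯*` has vertex data. With `u = (𝒯_∞ + 1)⁻¹ (v + w)`,
the difference `v - u` is in the kernel of `𝒯* + 1`, the orthogonal complement of the range of
`𝒯 + 1`. By Green's identity that range is the orthogonal complement of the exponential solution
with `k = 1`. -/
lemma mem_adjoint_graph_T_iff (hc : ∀ j, c j ≠ 0) {p : L2Y × L2Y} :
    p ∈ (T c).graph.adjoint ↔ ∃ d l m, HasVertexData c p d l m := by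
  refine ⟨fun hp => ?_, fun ⟨d, l, m, h⟩ => h.mem_adjoint_graph_T⟩
  obtain ⟨v, w⟩ := p
  obtain ⟨u, u₂, du, lu, hu, hsum⟩ := exists_neumann_solution_junction hc (w + v)
  obtain ⟨g, dg, hg⟩ := exists_exponential hc (k := 1) (by simp)
  simp only [one_pow, neg_smul, one_smul, div_one] at hg
  have hg0 : g ≠ 0 := hg.ne_zero
  set α : ℂ := ⟪g, v - u⟫_ℂ / ⟪g, g⟫_ℂ with hα
  set r : L2Y := v - u - α • g with hr
  have hgr : ⟪g, r⟫_ℂ = 0 := by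
    rw [hr, inner_sub_right, inner_smul_right, hα, div_mul_cancel₀ _ (inner_self_ne_zero.2 hg0),
      sub_self]
  have hrmem : (r, -r) ∈ (T c).graph.adjoint := by
    have h1 := Submodule.sub_mem _ (Submodule.sub_mem _ hp hu.mem_adjoint_graph_T)
      (hg.smul α).mem_adjoint_graph_T
    have h2 : w - u₂ = -(v - u) := by
      rw [← sub_eq_zero]
      calc w - u₂ - -(v - u) = (w + v) - (u₂ + u) := by abel
        _ = 0 := by rw [hsum, sub_self]
    convert h1 using 1
    refine Prod.ext rfl ?_
    simp only [Prod.snd_sub, h2, hr]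
    rw [smul_neg]
    abel
  obtain ⟨y, y₂, dy, ly, hy, hysum⟩ := exists_neumann_solution_junction hc r
  have hly : ly = 0 := by
    have h1 := hg.green hy
    have h2 : ⟪g, y₂⟫_ℂ + ⟪g, y⟫_ℂ = 0 := by rw [← inner_add_right, hysum, hgr]
    simp only [inner_neg_left, map_one, one_mul, mul_zero, sub_zero] at h1
    linear_combination -h1 - h2
  have hr0 : r = 0 := by
    have hyT : (y, y₂) ∈ (T c).graph := mem_graph_T_iff.2 ⟨dy, by rwa [hly] at hy⟩
    have h1 := (Submodule.mem_adjoint_iff _ _).1 hrmem _ _ hyT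
    simp only [inner_neg_right, sub_neg_eq_add] at h1
    rwa [← inner_add_left, hysum, inner_self_eq_zero] at h1
  have hv : v = u + α • g := by
    rw [hr, sub_sub, sub_eq_zero] at hr0
    exact hr0
  have hw : w = u₂ + α • -g := by
    have : w = u₂ + u - v := by rw [hsum]; abel
    rw [this, hv, smul_neg]
    abel
  have h := hu.add (hg.smul α)
  rw [← hv, ← hw] at h
  exact ⟨_, _, _, h⟩

lemma adjoint_graph_T (c : Fin 3 → ℝ) : (T c).adjoint.graph = (T c).graph.adjoint :=
  LinearPMap.adjoint_graph_eq_graph_adjoint (dense_domain_T c)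

/-- An extension of `𝒯` given by a Lagrangian set of boundary values is self-adjoint. -/
lemma isSelfAdjoint_of_lagrangian (hc : ∀ j, c j ≠ 0) {A : L2Y →ₗ.[ℂ] L2Y} {P : ℂ → ℂ → Prop}
    (hA : ∀ p, p ∈ A.graph ↔ ∃ d l m, HasVertexData c p d l m ∧ P l m)
    (hP : ∀ l m, P l m ↔ ∀ l' m', P l' m' → conj m' * l - conj l' * m = 0) :
    T c ≤ A ∧ IsSelfAdjoint A := by
  have hle : (T c).graph ≤ A.graph := fun p hp => by
    obtain ⟨d, hd⟩ := mem_graph_T_iff.1 hp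
    exact (hA p).2 ⟨d, 0, 0, hd, (hP 0 0).2 (by simp)⟩
  have hTA := LinearPMap.le_of_le_graph hle
  refine ⟨hTA, ?_⟩
  have hdense : Dense (A.domain : Set L2Y) := (dense_domain_T c).mono hTA.1
  rw [LinearPMap.isSelfAdjoint_def]
  refine LinearPMap.eq_of_eq_graph ?_
  rw [LinearPMap.adjoint_graph_eq_graph_adjoint hdense]
  ext p
  rw [hA, Submodule.mem_adjoint_iff]
  constructor
  · intro h
    obtain ⟨d, l, m, hd⟩ := (mem_adjoint_graph_T_iff hc).1 ((Submodule.mem_adjoint_iff _ p).2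
      fun a b hab => h a b (hle hab))
    refine ⟨d, l, m, hd, (hP l m).2 fun l' m' hl' => ?_⟩
    obtain ⟨q, e, hq⟩ := exists_hasVertexData hc l' m'
    rw [← hq.green hd]
    exact h q.1 q.2 ((hA q).2 ⟨e, l', m', hq, hl'⟩)
  · rintro ⟨d, l, m, hd, hlm⟩ a b hab
    obtain ⟨e, l', m', hq, hl'⟩ := (hA _).1 hab
    exact (hq.green hd).trans ((hP l m).1 hlm l' m' hl')

lemma isSelfAdjoint_TLam (hc : ∀ j, c j ≠ 0) (lam : ℝ) :
    T c ≤ TLam c lam ∧ IsSelfAdjoint (TLam c lam) := by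
  refine isSelfAdjoint_of_lagrangian hc (P := fun l m => l = lam * m)
    (fun p => mem_graph_TLam_iff) fun l m => ⟨?_, fun h => ?_⟩
  · rintro rfl l' m' rfl
    rw [map_mul, Complex.conj_ofReal]
    ring
  · have := h lam 1 (by simp)
    simp only [map_one, one_mul, Complex.conj_ofReal] at this
    exact sub_eq_zero.1 this

lemma isSelfAdjoint_TNeumann (hc : ∀ j, c j ≠ 0) :
    T c ≤ TNeumann c ∧ IsSelfAdjoint (TNeumann c) := by
  refine isSelfAdjoint_of_lagrangian hc (P := fun _ m => m = 0)
    (fun p => mem_graph_TNeumann_iff hc) fun l m => ⟨?_, fun h => ?_⟩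
  · rintro rfl l' m' rfl
    simp
  · simpa using h 1 0 rfl

lemma isSelfAdjoint_extension_iff (hc : ∀ j, c j ≠ 0) (A : L2Y →ₗ.[ℂ] L2Y) :
    (T c ≤ A ∧ IsSelfAdjoint A) ↔ (∃ lam : ℝ, A = TLam c lam) ∨ A = TNeumann c := by
  constructor
  · rintro ⟨hTA, hA⟩
    have hle := LinearPMap.le_graph_of_le hTA
    have hdata : ∀ p ∈ A.graph, ∃ d l m, HasVertexData c p d l m := fun p hp => by
      rw [← UnboundedOp.adjoint_graph_eq_self hA, Submodule.mem_adjoint_iff] at hp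
      exact (mem_adjoint_graph_T_iff hc).1 ((Submodule.mem_adjoint_iff _ p).2
        fun a b hab => hp a b (hle hab))
    have hsymm : ∀ p ∈ A.graph, ∀ q ∈ A.graph, ⟪q.2, p.1⟫_ℂ - ⟪q.1, p.2⟫_ℂ = 0 := by
      intro p hp q hq
      rw [← UnboundedOp.adjoint_graph_eq_self hA, Submodule.mem_adjoint_iff] at hp
      exact hp q.1 q.2 hq
    by_cases hm : ∀ p ∈ A.graph, ∀ d l m, HasVertexData c p d l m → m = 0
    · refine Or.inr (UnboundedOp.eq_of_graph_le_of_isSelfAdjoint hA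
        (isSelfAdjoint_TNeumann hc).2 ?_)
      intro p hp
      obtain ⟨d, l, m, h⟩ := hdata p hp
      exact (mem_graph_TNeumann_iff hc).2 ⟨d, l, m, h, hm p hp d l m h⟩
    · push Not at hm
      obtain ⟨q, hq, e, l₀, m₀, hq₀, hm₀⟩ := hm
      have hm₀' : conj m₀ ≠ 0 := (map_ne_zero _).2 hm₀
      have hself := (hq₀.green hq₀).symm.trans (hsymm q hq q hq)
      -- the quotient of the boundary values is the same for all elements of the graph, and real
      have hreal : conj (l₀ / m₀) = l₀ / m₀ := by
        rw [map_div₀, div_eq_div_iff hm₀' hm₀]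
        linear_combination -hself
      obtain ⟨lam, hlam⟩ := Complex.conj_eq_iff_real.1 hreal
      refine Or.inl ⟨lam, UnboundedOp.eq_of_graph_le_of_isSelfAdjoint hA
        (isSelfAdjoint_TLam hc lam).2 ?_⟩
      intro p hp
      obtain ⟨d, l, m, h⟩ := hdata p hp
      refine mem_graph_TLam_iff.2 ⟨d, l, m, h, ?_⟩
      have h1 := (hq₀.green h).symm.trans (hsymm p hp q hq)
      rw [← hlam, ← hreal, map_div₀, div_mul_eq_mul_div, eq_div_iff hm₀']
      linear_combination h1
  · rintro (⟨lam, rfl⟩ | rfl)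
    exacts [isSelfAdjoint_TLam hc lam, isSelfAdjoint_TNeumann hc]

lemma isFormalAdjoint_T (c : Fin 3 → ℝ) : (T c).IsFormalAdjoint (T c) := by
  intro x y
  obtain ⟨d, hd⟩ := mem_graph_T_iff.1 ((T c).mem_graph x)
  obtain ⟨e, he⟩ := mem_graph_T_iff.1 ((T c).mem_graph y)
  have := hd.green he
  simp only [map_zero, mul_zero, sub_zero] at this
  exact sub_eq_zero.1 this

/-- The domain of `𝒯` is cut out of that of `𝒯_∞` by the condition `∑ c_j u_j(0+) = 0`, which is a
closed condition since, by Green's identity, `-∑ c_j u_j(0+)` is the inner product of an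
exponential with `(𝒯_∞ + 1) u`. -/
lemma isClosed_T (hc : ∀ j, c j ≠ 0) : (T c).IsClosed := by
  obtain ⟨g, dg, hg⟩ := exists_exponential hc (k := 1) (by simp)
  simp only [one_pow, neg_smul, one_smul, div_one] at hg
  have heq : ((T c).graph : Set (L2Y × L2Y)) =
      ((TNeumann c).graph : Set (L2Y × L2Y)) ∩ {p | ⟪g, p.1 + p.2⟫_ℂ = 0} := by
    ext p
    have hval : ∀ d l, HasVertexData c p d l 0 → ⟪g, p.1 + p.2⟫_ℂ = -l := fun d l h => by
      have h1 := hg.green h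
      simp only [inner_neg_left, map_one, one_mul, mul_zero, sub_zero] at h1
      rw [inner_add_right]
      linear_combination -h1
    simp only [mem_inter_iff, SetLike.mem_coe, mem_graph_T_iff, mem_graph_TNeumann_iff hc]
    constructor
    · rintro ⟨d, h⟩
      refine ⟨⟨d, 0, 0, h, rfl⟩, ?_⟩
      change ⟪g, p.1 + p.2⟫_ℂ = 0
      rw [hval d 0 h, neg_zero]
    · rintro ⟨⟨d, l, m, h, rfl⟩, h0⟩
      change ⟪g, p.1 + p.2⟫_ℂ = 0 at h0
      rw [hval d l h, neg_eq_zero] at h0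
      exact ⟨d, h0 ▸ h⟩
  change IsClosed ((T c).graph : Set (L2Y × L2Y))
  rw [heq]
  exact (isSelfAdjoint_TNeumann hc).2.isClosed.inter
    (isClosed_eq (by fun_prop) continuous_const)

/-! ### Deficiency indices -/

lemma mem_eigenspace_iff {A : L2Y →ₗ.[ℂ] L2Y} {z : ℂ} {u : L2Y} :
    u ∈ UnboundedOp.eigenspace A z ↔ (u, z • u) ∈ A.graph := Iff.rfl

/-- For nonreal `z = -k²`, the kernel of `𝒯* - z` is spanned by an exponential: an element with
vanishing flux would be an eigenvector of the symmetric operator `𝒯_∞`. -/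
lemma rank_eigenspace_adjoint_T (hc : ∀ j, c j ≠ 0) {k z : ℂ} (hk : 0 < k.re) (hkz : -k ^ 2 = z)
    (hz : conj z ≠ z) : Module.rank ℂ (UnboundedOp.eigenspace (T c).adjoint z) = 1 := by
  obtain ⟨g, dg, hg⟩ := exists_exponential hc hk
  rw [hkz] at hg
  have hmem : ∀ u, u ∈ UnboundedOp.eigenspace (T c).adjoint z ↔
      ∃ d l m, HasVertexData c (u, z • u) d l m := fun u => by
    rw [mem_eigenspace_iff, adjoint_graph_T, mem_adjoint_graph_T_iff hc]
  refine rank_eq_one ⟨g, (hmem g).2 ⟨_, _, _, hg⟩⟩ 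
    (fun h => hg.ne_zero (congrArg Subtype.val h)) ?_
  rintro ⟨u, hu⟩
  obtain ⟨d, l, m, h⟩ := (hmem u).1 hu
  refine ⟨m, Subtype.ext ?_⟩
  change m • g = u
  have h1 := h.sub (hg.smul m)
  rw [smul_comm m z g, ← smul_sub, mul_one, sub_self] at h1
  have h2 := h1.green h1
  simp only [inner_smul_left, inner_smul_right, map_zero, zero_mul, mul_zero, sub_zero,
    ← sub_mul] at h2
  have h3 := (mul_eq_zero.1 h2).resolve_left (sub_ne_zero.2 hz)
  exact (sub_eq_zero.1 (inner_self_eq_zero.1 h3)).symm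

lemma deficiency_T (hc : ∀ j, c j ≠ 0) :
    UnboundedOp.deficiencyPlus (T c) = 1 ∧ UnboundedOp.deficiencyMinus (T c) = 1 := by
  have h2 : ((√2 : ℝ) : ℂ) ^ 2 = 2 := by
    rw [← Complex.ofReal_pow, Real.sq_sqrt (by norm_num)]
    norm_num
  -- the square roots of `∓i` with positive real part
  refine ⟨rank_eigenspace_adjoint_T hc (k := ((1 / √2 : ℝ) : ℂ) * (1 - Complex.I)) ?_ ?_ ?_,
    rank_eigenspace_adjoint_T hc (k := ((1 / √2 : ℝ) : ℂ) * (1 + Complex.I)) ?_ ?_ ?_⟩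
  · rw [Complex.re_ofReal_mul]; simp
  · rw [mul_pow, Complex.ofReal_div, div_pow, h2, Complex.ofReal_one]
    linear_combination (-1 / 2) * Complex.I_sq
  · rw [Complex.conj_I]
    exact fun h => Complex.I_ne_zero (self_eq_neg.1 h.symm)
  · rw [Complex.re_ofReal_mul]; simp
  · rw [mul_pow, Complex.ofReal_div, div_pow, h2, Complex.ofReal_one]
    linear_combination (-1 / 2) * Complex.I_sq
  · rw [map_neg, Complex.conj_I, neg_neg]
    exact fun h => Complex.I_ne_zero (self_eq_neg.1 h)

end YJunction

namespace YJunction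

open Set Filter Topology ComplexConjugate InnerProductSpace UnboundedOp

variable {c : Fin 3 → ℝ}

/-! ### The quadratic form and the negative eigenvalue -/

lemma HasVertexData.inner_self {u w d : L2Y} {l m : ℂ} {lam : ℝ}
    (h : HasVertexData c (u, w) d l m) (hl : l = lam * m) :
    ⟪u, w⟫_ℂ = ((∑ j, c j ^ 2 * ‖d j‖ ^ 2 + lam * ‖m‖ ^ 2 : ℝ) : ℂ) := by
  have h1 := h.inner_right h
  have h2 : conj m * m = ((‖m‖ : ℝ) : ℂ) ^ 2 := Complex.conj_mul' m
  simp only [inner_self_eq_norm_sq_to_K, hl, map_mul, Complex.conj_ofReal, mul_assoc, h2] at h1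
  rw [h1]
  push_cast
  rfl

lemma inner_self_TLam_of_pos {lam : ℝ} (hlam : 0 < lam) {u w : L2Y}
    (h : (u, w) ∈ (TLam c lam).graph) : ∃ q : ℝ, 0 ≤ q ∧ ⟪u, w⟫_ℂ = q := by
  obtain ⟨d, l, m, hd, hl⟩ := mem_graph_TLam_iff.1 h
  exact ⟨_, by positivity, hd.inner_self hl⟩

/-- For `λ < 0` an exponential `ψ` is an eigenfunction with the eigenvalue `-κ²`, where
`κ = -(|c₁| + |c₂| + |c₃|) / λ`, and `𝒯_λ` splits with respect to `ψ` and its orthogonal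
complement, where it is nonnegative. Indeed, if `v ⟂ ψ` has the flux `m`, then `v - m ψ` has no flux
and hence a nonnegative quadratic form, which differs from that of `v` by `-κ² |m|² ‖ψ‖²`. -/
lemma exists_decomposition_TLam (hc : ∀ j, c j ≠ 0) {lam : ℝ} (hlam : lam < 0) :
    ∃ κ : ℝ, 0 < κ ∧ ∃ ψ : L2Y, ψ ≠ 0 ∧ (ψ, (-(κ : ℂ) ^ 2) • ψ) ∈ (TLam c lam).graph ∧
      ∀ u w, (u, w) ∈ (TLam c lam).graph → ∃ (a : ℂ) (v v₂ : L2Y) (q : ℝ), u = a • ψ + v ∧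
        w = (-(κ : ℂ) ^ 2) • a • ψ + v₂ ∧ ⟪ψ, v⟫_ℂ = 0 ∧ ⟪ψ, v₂⟫_ℂ = 0 ∧
        0 ≤ q ∧ ⟪v, v₂⟫_ℂ = q := by
  have hS := sum_abs_pos hc
  set κ : ℝ := -(∑ j, |c j|) / lam with hκdef
  have hκ : 0 < κ := div_pos_of_neg_of_neg (neg_neg_of_pos hS) hlam
  obtain ⟨ψ, e, hψ⟩ := exists_exponential hc (k := (κ : ℂ)) (by simpa using hκ)
  have hl : -((∑ j, |c j| : ℝ) : ℂ) / (κ : ℂ) = lam * 1 := by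
    have : -(∑ j, |c j|) / κ = lam := by
      rw [hκdef]; field_simp
    rw [mul_one, ← this]
    push_cast
    rfl
  rw [hl] at hψ
  refine ⟨κ, hκ, ψ, hψ.ne_zero, mem_graph_TLam_iff.2 ⟨_, _, _, hψ, rfl⟩, fun u w h => ?_⟩
  obtain ⟨d, l, m, hd, hlm⟩ := mem_graph_TLam_iff.1 h
  set a : ℂ := ⟪ψ, u⟫_ℂ / ⟪ψ, ψ⟫_ℂ with ha
  set v : L2Y := u - a • ψ with hv
  set v₂ : L2Y := w - a • ((-(κ : ℂ) ^ 2) • ψ) with hv₂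
  have hvd : HasVertexData c (v, v₂) _ _ _ := hd.sub (hψ.smul a)
  have hvl : l - a * (lam * 1) = lam * (m - a * 1) := by rw [hlm]; ring
  have h0 : ⟪ψ, v⟫_ℂ = 0 := by
    rw [hv, inner_sub_right, inner_smul_right, ha,
      div_mul_cancel₀ _ (inner_self_ne_zero.2 hψ.ne_zero), sub_self]
  have h02 : ⟪ψ, v₂⟫_ℂ = 0 := by
    have h1 := hψ.green hvd
    rw [hvl] at h1
    simp only [inner_smul_left, h0, mul_zero, map_mul, Complex.conj_ofReal] at h1
    linear_combination -h1
  set m' : ℂ := m - a * 1 with hm'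
  refine ⟨a, v, v₂, _, by rw [hv]; abel, ?_, h0, h02, ?_, hvd.inner_self hvl⟩
  · rw [hv₂, smul_comm a]
    abel
  · have hw := hvd.sub (hψ.smul m')
    have h1 := hw.inner_self (lam := lam) (by rw [hvl]; ring)
    have h3 : ⟪v - m' • ψ, v₂ - m' • ((-(κ : ℂ) ^ 2) • ψ)⟫_ℂ =
        ⟪v, v₂⟫_ℂ - (κ : ℂ) ^ 2 * (((‖m'‖ : ℝ) : ℂ) ^ 2 * ((‖ψ‖ : ℝ) : ℂ) ^ 2) := by
      have h0' : ⟪v, ψ⟫_ℂ = 0 := by rw [← inner_conj_symm, h0, map_zero]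
      have h4 : ⟪ψ, ψ⟫_ℂ = ((‖ψ‖ : ℝ) : ℂ) ^ 2 := inner_self_eq_norm_sq_to_K ψ
      have h5 : conj m' * m' = ((‖m'‖ : ℝ) : ℂ) ^ 2 := Complex.conj_mul' m'
      simp only [inner_sub_left, inner_sub_right, inner_smul_left, inner_smul_right, h0', h02, h4,
        ← h5]
      ring
    rw [h3, hvd.inner_self hvl] at h1
    simp only [mul_one, sub_self, norm_zero, ne_eq, OfNat.ofNat_ne_zero, not_false_eq_true,
      zero_pow, mul_zero, add_zero] at h1
    have h6 : (∑ j, c j ^ 2 * ‖(d - a • e) j‖ ^ 2 + lam * ‖m'‖ ^ 2) -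
        κ ^ 2 * (‖m'‖ ^ 2 * ‖ψ‖ ^ 2) = ∑ j, c j ^ 2 * ‖(d - a • e - m' • e) j‖ ^ 2 := by
      exact_mod_cast h1
    have h7 : 0 ≤ κ ^ 2 * (‖m'‖ ^ 2 * ‖ψ‖ ^ 2) := by positivity
    have h8 : 0 ≤ ∑ j, c j ^ 2 * ‖(d - a • e - m' • e) j‖ ^ 2 := by positivity
    linarith

/-- For `λ < 0`, there is a simple eigenvalue `-κ²`, and `𝒯_λ - z` is bounded below for all `z`
other than this eigenvalue and the points of `[0, ∞)`. -/
lemma TLam_bounded_below_of_neg (hc : ∀ j, c j ≠ 0) {lam : ℝ} (hlam : lam < 0) :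
    ∃ κ : ℝ, 0 < κ ∧ IsEigenvalue (TLam c lam) (-(κ : ℂ) ^ 2) ∧
      Module.rank ℂ (eigenspace (TLam c lam) (-(κ : ℂ) ^ 2)) = 1 ∧
      ∀ z : ℂ, z ∉ (fun t : ℝ => (t : ℂ)) '' Ici 0 → z ≠ -(κ : ℂ) ^ 2 →
        ∃ δ > 0, ∀ u w, (u, w) ∈ (TLam c lam).graph → δ * ‖u‖ ≤ ‖w - z • u‖ := by
  obtain ⟨κ, hκ, ψ, hψ0, hψ, hdec⟩ := exists_decomposition_TLam hc hlam
  refine ⟨κ, hκ, fun h => hψ0 ?_, ?_, ?_⟩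
  · rw [Submodule.eq_bot_iff] at h
    exact h ψ hψ
  · refine rank_eq_one ⟨ψ, hψ⟩ (fun h => hψ0 (congrArg Subtype.val h)) ?_
    rintro ⟨u, hu⟩
    have hcast : ((-κ ^ 2 : ℝ) : ℂ) = -(κ : ℂ) ^ 2 := by push_cast; ring
    obtain ⟨a, v, v₂, q, e1, e2, -, -, hq, hvq⟩ := hdec u ((-(κ : ℂ) ^ 2) • u) hu
    refine ⟨a, Subtype.ext ?_⟩
    change a • ψ = u
    obtain ⟨δ, hδ, hb⟩ := exists_pos_bounded_below_of_nonneg (E := L2Y)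
      (z := -(κ : ℂ) ^ 2) (by
        rintro ⟨t, ht, h⟩
        have h1 : t = -κ ^ 2 := Complex.ofReal_injective (by rw [← hcast] at h; exact h)
        have h2 : (0 : ℝ) ≤ t := ht
        nlinarith [sq_pos_of_pos hκ])
    have h1 := hb v v₂ q hq hvq
    have h2 : v₂ - (-(κ : ℂ) ^ 2) • v = 0 := by
      have : v₂ = (-(κ : ℂ) ^ 2) • u - (-(κ : ℂ) ^ 2) • a • ψ := by rw [e2]; abel
      rw [this, e1, smul_add]
      abel
    rw [h2, norm_zero] at h1
    have hv : v = 0 := norm_le_zero_iff.1 (nonpos_of_mul_nonpos_right h1 hδ)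
    rw [e1, hv, add_zero]
  · intro z hz hzκ
    obtain ⟨δ, hδ, hb⟩ := exists_pos_bounded_below_of_nonneg (E := L2Y) hz
    have hκz : 0 < ‖-(κ : ℂ) ^ 2 - z‖ := norm_pos_iff.2 (sub_ne_zero.2 hzκ.symm)
    refine ⟨min δ ‖-(κ : ℂ) ^ 2 - z‖, lt_min hδ hκz, fun u w h => ?_⟩
    obtain ⟨a, v, v₂, q, e1, e2, h0, h02, hq, hvq⟩ := hdec _ _ h
    set μ := min δ ‖-(κ : ℂ) ^ 2 - z‖ with hμ
    have hμ0 : 0 < μ := lt_min hδ hκz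
    have e3 : w - z • u = (-(κ : ℂ) ^ 2 - z) • a • ψ + (v₂ - z • v) := by
      rw [e1, e2, sub_smul, smul_add]
      abel
    have p1 := norm_add_sq_eq_norm_sq_add_norm_sq_of_inner_eq_zero (𝕜 := ℂ) (a • ψ) v
      (by rw [inner_smul_left, h0, mul_zero])
    have p2 := norm_add_sq_eq_norm_sq_add_norm_sq_of_inner_eq_zero (𝕜 := ℂ)
      ((-(κ : ℂ) ^ 2 - z) • a • ψ) (v₂ - z • v) (by
        rw [inner_smul_left, inner_smul_left, inner_sub_right, inner_smul_right, h0, h02]; simp)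
    have b1 : μ * ‖v‖ ≤ ‖v₂ - z • v‖ :=
      (mul_le_mul_of_nonneg_right (min_le_left _ _) (norm_nonneg _)).trans (hb v v₂ q hq hvq)
    have b2 : μ * ‖a • ψ‖ ≤ ‖(-(κ : ℂ) ^ 2 - z) • a • ψ‖ := by
      rw [norm_smul (-(κ : ℂ) ^ 2 - z)]
      exact mul_le_mul_of_nonneg_right (min_le_right _ _) (norm_nonneg _)
    have b3 := mul_self_le_mul_self (by positivity) b1
    have b4 := mul_self_le_mul_self (by positivity) b2
    rw [← e1] at p1
    rw [← e3] at p2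
    refine abs_le_of_sq_le_sq' ?_ (norm_nonneg _) |>.2
    have e4 : (μ * ‖u‖) ^ 2 = μ * ‖a • ψ‖ * (μ * ‖a • ψ‖) + μ * ‖v‖ * (μ * ‖v‖) := by
      linear_combination μ ^ 2 * p1
    rw [e4, sq, p2]
    exact add_le_add b4 b3

/-! ### Absence of nonnegative eigenvalues, and approximate eigenfunctions -/

/-- `𝒯_λ` has no eigenvalues in `[0, ∞)`: with `κ² = -t / c_j²`, the equation `-c_j² u'' = t u`
factors into first order equations for `u' - κ u` and `u`. -/
lemma eq_zero_of_eigenvector_nonneg (hc : ∀ j, c j ≠ 0) {d u : L2Y} {l m : ℂ} {t : ℝ} (ht : 0 ≤ t)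
    (h : HasVertexData c (u, (t : ℂ) • u) d l m) : u = 0 := by
  obtain ⟨s, a, b, h, e, -, -⟩ := h
  ext1 j
  have hcC : (c j : ℂ) ≠ 0 := Complex.ofReal_ne_zero.2 (hc j)
  set κ : ℂ := Complex.I * ((√t / c j : ℝ) : ℂ) with hκ
  have hκre : κ.re = 0 := by rw [hκ, mul_comm, Complex.re_ofReal_mul]; simp
  have hκ2 : κ ^ 2 = -(t : ℂ) / (c j : ℂ) ^ 2 := by
    rw [hκ, mul_pow, Complex.I_sq, ← Complex.ofReal_pow, div_pow, Real.sq_sqrt ht]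
    push_cast
    ring
  have hs : s j = (κ ^ 2) • u j := by
    have h1 : (t : ℂ) • u j = (-(c j : ℂ) ^ 2) • s j := e j
    have h2 : s j = (-(c j : ℂ) ^ 2)⁻¹ • (t : ℂ) • u j := by
      rw [h1, inv_smul_smul₀ (neg_ne_zero.2 (pow_ne_zero 2 hcC))]
    rw [h2, smul_smul, hκ2]
    congr 1
    field_simp
  have h1 : IsWeakDeriv (d j + (-κ) • u j) ((-κ) • (d j + (-κ) • u j)) := by
    have := (h.weakDeriv₂ j).add ((h.weakDeriv j).smul (-κ))
    rw [hs] at this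
    convert this using 1
    rw [smul_add, smul_smul, neg_mul_neg, ← sq, add_comm]
  have h2 := h1.eq_zero_of_eq_smul (by simp [hκre])
  rw [neg_smul, ← sub_eq_add_neg, sub_eq_zero] at h2
  have h3 := h.weakDeriv j
  change IsWeakDeriv (u j) (d j) at h3
  rw [h2] at h3
  exact h3.eq_zero_of_eq_smul hκre.ge

/-- The half-line `[0, ∞)` is in the spectrum. The functions `x² exp ((iτ - ε) x)` on the first
edge, with `τ = √t / |c₁|`, have vanishing vertex data, and `𝒯_λ - t` multiplies their norm by
`O(ε)` as `ε → 0`. -/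
lemma nonneg_mem_spectrum_TLam (hc : ∀ j, c j ≠ 0) (lam : ℝ) {t : ℝ} (ht : 0 ≤ t) :
    (t : ℂ) ∈ UnboundedOp.spectrum (TLam c lam) := by
  intro hres
  obtain ⟨C, hC, hb⟩ := bounded_below_of_mem_resolventSet hres
  set τ : ℝ := √t / |c 0| with hτ
  have hτ0 : 0 ≤ τ := by positivity
  have hcτ : c 0 ^ 2 * τ ^ 2 = t := by
    rw [hτ, div_pow, Real.sq_sqrt ht, sq_abs]
    field_simp [hc 0]
  set M : ℝ := C * (c 0 ^ 2 * (17 + 10 * τ)) with hM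
  have hM0 : 0 ≤ M := by positivity
  set ε : ℝ := 1 / (M + 1) with hε
  have hε0 : 0 < ε := by positivity
  have hε1 : ε ≤ 1 := by
    rw [hε, div_le_one (by positivity)]; linarith
  have hMε : M * ε < 1 := by
    rw [hε, mul_one_div, div_lt_one (by positivity)]; linarith
  set p : ℂ := -(ε : ℂ) + τ * Complex.I with hp
  have hpre : p.re = -ε := by simp [hp]
  have hpneg : p.re < 0 := by rw [hpre]; linarith
  let E : L2Half → L2Y := fun f => WithLp.toLp 2 (Pi.single 0 f)
  have hE : ∀ (f : L2Half) (i), E f i = if i = 0 then f else 0 := fun f i => by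
    simp [E, Pi.single_apply]
  have hnE : ∀ f, ‖E f‖ = ‖f‖ := fun f => by
    rw [PiLp.norm_eq_of_L2, Fin.sum_univ_three, hE, hE, hE]
    simp
  set u := expPoly hpneg 0 0 1 with hu
  set s := expPoly hpneg 2 (4 * p) (p ^ 2) with hs
  have hmem : (E u, (-(c 0 : ℂ) ^ 2) • E s) ∈ (TLam c lam).graph := by
    refine mem_graph_TLam_iff.2 ⟨E (expPoly hpneg 0 2 p), 0, 0, ⟨E s, 0, 0,
      ⟨fun i => ?_, fun i => ?_, fun i => ?_, fun i => ?_⟩, fun i => ?_, by simp, by simp⟩,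
      by simp⟩
    · rw [hE, hE]
      split_ifs
      exacts [isWeakDeriv_expPoly_of_eq hpneg (by ring) (by ring) (by ring), isWeakDeriv_zero]
    · rw [hE, hE]
      split_ifs
      exacts [isWeakDeriv_expPoly_of_eq hpneg (by ring) (by ring) (by ring), isWeakDeriv_zero]
    · rw [hE]
      split_ifs
      exacts [hasTrace_expPoly _ _ _ _, hasTrace_zero]
    · rw [hE]
      split_ifs
      exacts [hasTrace_expPoly _ _ _ _, hasTrace_zero]
    · rw [PiLp.smul_apply, hE]
      split_ifs with hi
      · rw [hi]
      · rw [smul_zero, smul_zero]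
  have h1 := hb _ _ hmem
  -- the image of the test function under `𝒯_λ - t`
  have himg : (-(c 0 : ℂ) ^ 2) • E s - (t : ℂ) • E u =
      E ((-(c 0 : ℂ) ^ 2) • ((2 : ℂ) • expPoly hpneg 1 0 0 + (4 * p) • expPoly hpneg 0 1 0 +
        (p ^ 2 + (τ : ℂ) ^ 2) • u)) := by
    ext1 i
    rw [PiLp.sub_apply, PiLp.smul_apply, PiLp.smul_apply, hE, hE, hE]
    split_ifs
    · rw [hs, hu, sub_eq_add_neg, ← neg_smul (t : ℂ)]
      simp only [smul_expPoly, expPoly_add, ← hcτ]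
      congr 1 <;> push_cast <;> ring
    · simp
  rw [himg, hnE, hnE, norm_smul] at h1
  set n₀ := ‖expPoly hpneg 1 0 0‖ with hn₀
  set n₁ := ‖expPoly hpneg 0 1 0‖ with hn₁
  have q0 : n₀ ^ 2 = 1 / (2 * ε) := by
    rw [hn₀, norm_sq_expPoly_one, hpre]; congr 1; ring
  have q1 : n₁ ^ 2 = 2 / (2 * ε) ^ 3 := by
    rw [hn₁, norm_sq_expPoly_X, hpre]; congr 2; ring
  have q2 : ‖u‖ ^ 2 = 24 / (2 * ε) ^ 5 := by
    rw [hu, norm_sq_expPoly_X_sq, hpre]; congr 2; ring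
  have hu0 : 0 < ‖u‖ := by
    refine lt_of_le_of_ne (norm_nonneg _) fun h => ?_
    rw [← h] at q2
    have : 0 < 24 / (2 * ε) ^ 5 := by positivity
    simp only [ne_eq, OfNat.ofNat_ne_zero, not_false_eq_true, zero_pow] at q2
    linarith
  have b0 : n₀ ≤ (2 * ε) ^ 2 * ‖u‖ := by
    refine (abs_le_of_sq_le_sq' ?_ (by positivity)).2
    rw [mul_pow, q2, q0]
    have : ((2 * ε) ^ 2) ^ 2 * (24 / (2 * ε) ^ 5) = 24 / (2 * ε) := by field_simp
    rw [this]
    gcongr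
    norm_num
  have b1 : n₁ ≤ (2 * ε) * ‖u‖ := by
    refine (abs_le_of_sq_le_sq' ?_ (by positivity)).2
    rw [mul_pow, q2, q1]
    have : (2 * ε) ^ 2 * (24 / (2 * ε) ^ 5) = 24 / (2 * ε) ^ 3 := by field_simp
    rw [this]
    gcongr
    norm_num
  have hpn : ‖p‖ ≤ 1 + τ := by
    refine (norm_add_le _ _).trans ?_
    rw [norm_neg, norm_mul, Complex.norm_I, Complex.norm_real, Complex.norm_real,
      Real.norm_of_nonneg hε0.le, Real.norm_of_nonneg hτ0]
    linarith
  have hpτ : ‖p ^ 2 + (τ : ℂ) ^ 2‖ ≤ ε * (1 + 2 * τ) := by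
    have : p ^ 2 + (τ : ℂ) ^ 2 = (ε : ℂ) * ((ε : ℂ) - 2 * τ * Complex.I) := by
      rw [hp]
      linear_combination (τ : ℂ) ^ 2 * Complex.I_sq
    rw [this, norm_mul, Complex.norm_real, Real.norm_of_nonneg hε0.le]
    gcongr
    refine (norm_sub_le _ _).trans ?_
    rw [norm_mul, norm_mul, Complex.norm_I, Complex.norm_real, Complex.norm_real,
      Real.norm_of_nonneg hε0.le, Real.norm_of_nonneg hτ0]
    simp only [Complex.norm_ofNat]
    linarith
  have b2 : ‖(2 : ℂ) • expPoly hpneg 1 0 0 + (4 * p) • expPoly hpneg 0 1 0 +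
      (p ^ 2 + (τ : ℂ) ^ 2) • u‖ ≤ ε * (17 + 10 * τ) * ‖u‖ := by
    calc _ ≤ 2 * n₀ + 4 * ‖p‖ * n₁ + ‖p ^ 2 + (τ : ℂ) ^ 2‖ * ‖u‖ := by
          refine (norm_add₃_le).trans (le_of_eq ?_)
          rw [norm_smul, norm_smul, norm_smul, norm_mul, Complex.norm_ofNat, Complex.norm_ofNat]
      _ ≤ 2 * ((2 * ε) ^ 2 * ‖u‖) + 4 * (1 + τ) * ((2 * ε) * ‖u‖) +
          ε * (1 + 2 * τ) * ‖u‖ := by gcongr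
      _ = ε * (8 * ε + 9 + 10 * τ) * ‖u‖ := by ring
      _ ≤ ε * (17 + 10 * τ) * ‖u‖ := by
          gcongr
          linarith
  have hcn : ‖-(c 0 : ℂ) ^ 2‖ = c 0 ^ 2 := by
    rw [norm_neg, norm_pow, Complex.norm_real, Real.norm_eq_abs, sq_abs]
  have h2 : ‖u‖ ≤ M * ε * ‖u‖ := by
    refine h1.trans ?_
    rw [hcn]
    calc _ ≤ C * (c 0 ^ 2 * (ε * (17 + 10 * τ) * ‖u‖)) := by gcongr
      _ = M * ε * ‖u‖ := by rw [hM]; ring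
  have h3 := mul_lt_mul_of_pos_right hMε hu0
  linarith

/-! ### The spectrum of `𝒯_λ` -/

lemma conj_notMem_half_line {z : ℂ} (hz : z ∉ (fun t : ℝ => (t : ℂ)) '' Ici 0) :
    conj z ∉ (fun t : ℝ => (t : ℂ)) '' Ici 0 := by
  rintro ⟨t, ht, h⟩
  refine hz ⟨t, ht, ?_⟩
  rw [← Complex.conj_conj z, ← h, Complex.conj_ofReal]

lemma eq_zero_of_bounded_below {A : L2Y →ₗ.[ℂ] L2Y} {z : ℂ} {δ : ℝ} (hδ : 0 < δ)
    (h : ∀ u w, (u, w) ∈ A.graph → δ * ‖u‖ ≤ ‖w - z • u‖) {u : L2Y}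
    (hu : (u, z • u) ∈ A.graph) : u = 0 := by
  have h1 := h _ _ hu
  rw [sub_self, norm_zero] at h1
  exact norm_le_zero_iff.1 (nonpos_of_mul_nonpos_right h1 hδ)

lemma spectrum_TLam_subset_of_bounded_below (hc : ∀ j, c j ≠ 0) {lam : ℝ} {S : Set ℂ}
    (hS : ∀ z ∉ S, conj z ∉ S)
    (hb : ∀ z ∉ S, ∃ δ > 0, ∀ u w, (u, w) ∈ (TLam c lam).graph → δ * ‖u‖ ≤ ‖w - z • u‖) :
    UnboundedOp.spectrum (TLam c lam) ⊆ S := by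
  intro z hz
  by_contra hzS
  obtain ⟨δ, hδ, h⟩ := hb z hzS
  obtain ⟨δ', hδ', h'⟩ := hb _ (hS z hzS)
  exact hz (mem_resolventSet_of_bounded_below (isSelfAdjoint_TLam hc lam).2 hδ h
    fun u hu => eq_zero_of_bounded_below hδ' h' hu)

/-- Points of `[0, ∞)` are not isolated in the spectrum, so they are in the essential spectrum. -/
lemma half_line_subset_essentialSpectrum (hc : ∀ j, c j ≠ 0) (lam : ℝ) :
    (fun t : ℝ => (t : ℂ)) '' Ici 0 ⊆ essentialSpectrum (TLam c lam) := by
  rintro _ ⟨t, ht, rfl⟩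
  have ht0 : (0 : ℝ) ≤ t := ht
  refine ⟨nonneg_mem_spectrum_TLam hc lam ht0, ?_⟩
  rintro ⟨-, ⟨ε, hε, h⟩, -⟩
  have h1 := h _ (nonneg_mem_spectrum_TLam hc lam (t := t + ε / 2) (by positivity)) (by
    rw [← Complex.ofReal_sub, Complex.norm_real, add_sub_cancel_left,
      Real.norm_of_nonneg (by positivity)]
    linarith)
  have h2 : t + ε / 2 = t := Complex.ofReal_injective h1
  linarith

lemma TLam_bounded_below_of_pos {lam : ℝ} (hlam : 0 < lam) {z : ℂ}
    (hz : z ∉ (fun t : ℝ => (t : ℂ)) '' Ici 0) :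
    ∃ δ > 0, ∀ u w, (u, w) ∈ (TLam c lam).graph → δ * ‖u‖ ≤ ‖w - z • u‖ := by
  obtain ⟨δ, hδ, h⟩ := exists_pos_bounded_below_of_nonneg (E := L2Y) hz
  refine ⟨δ, hδ, fun u w huw => ?_⟩
  obtain ⟨q, hq, e⟩ := inner_self_TLam_of_pos hlam huw
  exact h u w q hq e

lemma essentialSpectrum_TLam (hc : ∀ j, c j ≠ 0) {lam : ℝ} (hlam : lam ≠ 0) :
    essentialSpectrum (TLam c lam) = (fun t : ℝ => (t : ℂ)) '' Ici 0 := by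
  refine Subset.antisymm ?_ (half_line_subset_essentialSpectrum hc lam)
  rcases hlam.lt_or_gt with hneg | hpos
  · obtain ⟨κ, hκ, heig, hrank, hb⟩ := TLam_bounded_below_of_neg hc hneg
    have hsub : UnboundedOp.spectrum (TLam c lam) ⊆
        insert (-(κ : ℂ) ^ 2) ((fun t : ℝ => (t : ℂ)) '' Ici 0) := by
      refine spectrum_TLam_subset_of_bounded_below hc (fun z hz => ?_) fun z hz => ?_
      · rw [mem_insert_iff, not_or] at hz ⊢
        refine ⟨fun h => hz.1 ?_, conj_notMem_half_line hz.2⟩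
        rw [← Complex.conj_conj z, h]
        simp
      · rw [mem_insert_iff, not_or] at hz
        exact hb z hz.2 hz.1
    rintro z ⟨hz, hzd⟩
    refine (hsub hz).resolve_left ?_
    rintro rfl
    -- the eigenvalue `-κ²` has the distance `κ²` from the rest of the spectrum
    refine hzd ⟨hz, ⟨κ ^ 2, by positivity, fun w hw hdist => ?_⟩, heig, ?_⟩
    · refine (hsub hw).resolve_right ?_
      rintro ⟨t, ht, rfl⟩
      have ht0 : (0 : ℝ) ≤ t := ht
      have e : (t : ℂ) - -(κ : ℂ) ^ 2 = ((t + κ ^ 2 : ℝ) : ℂ) := by push_cast; ring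
      rw [e, Complex.norm_real, Real.norm_of_nonneg (by positivity)] at hdist
      linarith
    · exact Module.finite_of_rank_eq_one hrank
  · exact sdiff_subset.trans (spectrum_TLam_subset_of_bounded_below hc
      (fun z hz => conj_notMem_half_line hz) fun z hz => TLam_bounded_below_of_pos hpos hz)

lemma exists_unique_negative_eigenvalue_TLam (hc : ∀ j, c j ≠ 0) {lam : ℝ} (hlam : lam < 0) :
    ∃ μ : ℝ, μ < 0 ∧ IsEigenvalue (TLam c lam) μ ∧
      Module.finrank ℂ (eigenspace (TLam c lam) μ) = 1 ∧
      ∀ ν : ℝ, ν < 0 → IsEigenvalue (TLam c lam) ν → ν = μ := by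
  obtain ⟨κ, hκ, heig, hrank, hb⟩ := TLam_bounded_below_of_neg hc hlam
  have hcast : ((-κ ^ 2 : ℝ) : ℂ) = -(κ : ℂ) ^ 2 := by push_cast; ring
  refine ⟨-κ ^ 2, by nlinarith [sq_pos_of_pos hκ], hcast ▸ heig,
    hcast ▸ Module.rank_eq_one_iff_finrank_eq_one.1 hrank, fun ν hν hνe => ?_⟩
  by_contra hne
  obtain ⟨δ, hδ, h⟩ := hb ν (by
    rintro ⟨t, ht, h⟩
    have h1 : t = ν := Complex.ofReal_injective h
    have h2 : (0 : ℝ) ≤ t := ht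
    linarith) (by
    rw [← hcast]
    exact fun h => hne (Complex.ofReal_injective h))
  exact hνe ((Submodule.eq_bot_iff _).2 fun u hu => eq_zero_of_bounded_below hδ h hu)

lemma not_isEigenvalue_TLam (hc : ∀ j, c j ≠ 0) {lam : ℝ} (hlam : 0 < lam) (z : ℂ) :
    ¬ IsEigenvalue (TLam c lam) z := by
  rw [IsEigenvalue, not_not, Submodule.eq_bot_iff]
  intro u hu
  by_cases hz : z ∈ (fun t : ℝ => (t : ℂ)) '' Ici 0
  · obtain ⟨t, ht, rfl⟩ := hz
    obtain ⟨d, l, m, h, -⟩ := mem_graph_TLam_iff.1 hu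
    exact eq_zero_of_eigenvector_nonneg hc ht h
  · obtain ⟨δ, hδ, h⟩ := TLam_bounded_below_of_pos hlam hz
    exact eq_zero_of_bounded_below hδ h hu

end YJunction
end

theorem proposition3p1 (c : Fin 3 → ℝ) (hc : ∀ j, c j ≠ 0) :
    -- `T` is densely defined, closed and symmetric
    (Dense ((YJunction.T c).domain : Set YJunction.L2Y) ∧
      (YJunction.T c).IsClosed ∧ (YJunction.T c).IsFormalAdjoint (YJunction.T c)) ∧
    -- its deficiency indices
    (UnboundedOp.deficiencyPlus (YJunction.T c) = 1 ∧
      UnboundedOp.deficiencyMinus (YJunction.T c) = 1) ∧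
    -- its self-adjoint extensions
    (∀ A : YJunction.L2Y →ₗ.[ℂ] YJunction.L2Y, (YJunction.T c ≤ A ∧ IsSelfAdjoint A) ↔
      (∃ lam : ℝ, A = YJunction.TLam c lam) ∨ A = YJunction.TNeumann c) ∧
    -- the essential spectrum
    (∀ lam : ℝ, lam ≠ 0 →
      UnboundedOp.essentialSpectrum (YJunction.TLam c lam) = (fun t : ℝ => (t : ℂ)) '' Set.Ici 0) ∧
    -- for `lam < 0`, precisely one negative eigenvalue, and it is simple
    (∀ lam : ℝ, lam < 0 → ∃ μ : ℝ, μ < 0 ∧ UnboundedOp.IsEigenvalue (YJunction.TLam c lam) μ ∧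
      Module.finrank ℂ (UnboundedOp.eigenspace (YJunction.TLam c lam) μ) = 1 ∧
      ∀ ν : ℝ, ν < 0 → UnboundedOp.IsEigenvalue (YJunction.TLam c lam) ν → ν = μ) ∧
    -- for `lam > 0`, no eigenvalues
    (∀ lam : ℝ, 0 < lam → ∀ z : ℂ, ¬ UnboundedOp.IsEigenvalue (YJunction.TLam c lam) z) :=
  ⟨⟨YJunction.dense_domain_T c, YJunction.isClosed_T hc, YJunction.isFormalAdjoint_T c⟩,
    YJunction.deficiency_T hc, YJunction.isSelfAdjoint_extension_iff hc,
    fun _ => YJunction.essentialSpectrum_TLam hc,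
    fun _ => YJunction.exists_unique_negative_eigenvalue_TLam hc,
    fun _ => YJunction.not_isEigenvalue_TLam hc⟩
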